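/- Let $I^5=[0,1]^5\subset\mathbb{R}^5$. A binary simplex is a nondegenerate $5$-simplex whose six vertices belong to $\{0,1\}^5$; it is nonobtuse if none of its dihedral angles exceeds $\pi/2$. A nonobtuse binary triangulation of $I^5$ is a set of nonobtuse binary simplices whose union is $I^5$ and which meet face to face (any two intersect in the convex hull of their common vertices). For $n\ge 1$ let $e_1,\dots,e_n$ be the standard basis of $\mathbb{R}^n$ and $e^n=(1,\dots,1)$. The standard triangulation $\mathcal{T}_\mathcal{S}^n$ of $[0,1]^n$ consists of the $n!$ path simplices with vertices $0,\ e_{\sigma(1)},\ e_{\sigma(1)}+e_{\sigma(2)},\ \dots,\ e^n$, where $\sigma$ runs over the permutations of $\{1,\dots,n\}$. Let $K^n$ be the simplex with vertices $0,e_1,\dots,e_n$ and, for $n\ge 2$, let $A^n$ be the simplex with vertices $e^n,e_1,\dots,e_n$. Put $\mathcal{T}_\mathcal{N}^1=\{K^1\}$ and, for $n\ge 2$, let $\mathcal{T}_\mathcal{N}^n$ consist of $K^n$, $A^n$ and all simplices $\operatorname{conv}(\{e^n\}\cup\iota_j(R))$ with $1\le j\le n$ and $R\in\mathcal{T}_\mathcal{N}^{n-1}\setminus\{K^{n-1}\}$,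 where $\iota_j:\mathbb{R}^{n-1}\to\mathbb{R}^n$ inserts a zero as $j$-th coordinate. Theorem. Up to the symmetries of the cube, $\mathcal{T}_\mathcal{S}^5$ and $\mathcal{T}_\mathcal{N}^5$ are the only nonobtuse binary triangulations of $I^5$. That is, a set $\mathcal{T}$ of simplices is a nonobtuse binary triangulation of $I^5$ if and only if there is an isometry $g$ of $\mathbb{R}^5$ with $g(I^5)=I^5$ such that $\mathcal{T}=g(\mathcal{T}_\mathcal{S}^5)$ or $\mathcal{T}=g(\mathcal{T}_\mathcal{N}^5)$. -/

import Mathlib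

noncomputable section

namespace CubeTriangulation

open Set

/-- The unit cube `[0,1]ⁿ` in Euclidean space. -/
def unitCube (n : ℕ) : Set (EuclideanSpace ℝ (Fin n)) :=
  {x | ∀ i, x i ∈ Icc (0 : ℝ) 1}

/-- The set of the `2ⁿ` vertices of the unit cube. -/
def cubeVertices (n : ℕ) : Set (EuclideanSpace ℝ (Fin n)) :=
  {x | ∀ i, x i = 0 ∨ x i = 1}

/-- `S` is the vertex set of a (nondegenerate) binary `n`-simplex: `n + 1` affinely independent
vertices of the unit cube. Simplices are represented by their vertex sets; the simplex itself is
`convexHull ℝ S`. -/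
structure IsBinarySimplex {n : ℕ} (S : Set (EuclideanSpace ℝ (Fin n))) : Prop where
  subset_cubeVertices : S ⊆ cubeVertices n
  ncard_eq : S.ncard = n + 1
  affineIndependent : AffineIndependent ℝ ((↑) : S → EuclideanSpace ℝ (Fin n))

/-- `u` is an outward normal vector to the facet opposite the vertex `p` of the simplex with vertex
set `S`: it is nonzero, orthogonal to the facet, and `p` lies strictly on the negative side of the
hyperplane through the facet. -/
def IsOutwardNormal {n : ℕ} (S : Set (EuclideanSpace ℝ (Fin n)))
    (p u : EuclideanSpace ℝ (Fin n)) : Prop :=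
  u ≠ 0 ∧ (∀ x ∈ S \ {p}, ∀ y ∈ S \ {p}, inner ℝ u (x - y) = 0) ∧
    ∀ x ∈ S \ {p}, inner ℝ u (p - x) < 0

/-- `θ` is the dihedral angle between the facets opposite `p` and `q` of the simplex with vertex set
`S`, that is, `π` minus the angle between the outward normals of these facets. -/
def IsDihedralAngle {n : ℕ} (S : Set (EuclideanSpace ℝ (Fin n)))
    (p q : EuclideanSpace ℝ (Fin n)) (θ : ℝ) : Prop :=
  ∃ u v, IsOutwardNormal S p u ∧ IsOutwardNormal S q v ∧
    θ = Real.pi - InnerProductGeometry.angle u v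

/-- No dihedral angle of the simplex with vertex set `S` is obtuse. -/
def IsNonobtuse {n : ℕ} (S : Set (EuclideanSpace ℝ (Fin n))) : Prop :=
  ∀ p ∈ S, ∀ q ∈ S, p ≠ q → ∀ θ, IsDihedralAngle S p q θ → θ ≤ Real.pi / 2

/-- A binary triangulation of the unit cube: a set of binary `n`-simplices that cover the cube and
meet face to face, that is, any two of them intersect exactly in the (possibly empty) common face
spanned by their common vertices. In particular distinct simplices have disjoint interiors. -/
structure IsBinaryTriangulation {n : ℕ} (T : Set (Set (EuclideanSpace ℝ (Fin n)))) : Prop where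
  isBinarySimplex : ∀ S ∈ T, IsBinarySimplex S
  cover : ⋃ S ∈ T, convexHull ℝ S = unitCube n
  face_to_face : ∀ S ∈ T, ∀ S' ∈ T,
    convexHull ℝ S ∩ convexHull ℝ S' = convexHull ℝ (S ∩ S')

/-- A binary triangulation of the unit cube all of whose simplices are nonobtuse. -/
def IsNonobtuseBinaryTriangulation {n : ℕ} (T : Set (Set (EuclideanSpace ℝ (Fin n)))) : Prop :=
  IsBinaryTriangulation T ∧ ∀ S ∈ T, IsNonobtuse S

/-- The path simplex from the origin to the all-ones vector that runs along the coordinate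
directions in the order `σ 0, σ 1, …`: its vertices are `∑ i < k, e_{σ i}` for `k = 0, …, n`. -/
def pathSimplex {n : ℕ} (σ : Equiv.Perm (Fin n)) : Set (EuclideanSpace ℝ (Fin n)) :=
  range fun k : Fin (n + 1) =>
    ∑ i ∈ Finset.univ.filter (fun i : Fin n => (i : ℕ) < (k : ℕ)),
      EuclideanSpace.single (σ i) (1 : ℝ)

/-- The standard triangulation of the cube into `n!` path simplices. -/
def standardTriangulation (n : ℕ) : Set (Set (EuclideanSpace ℝ (Fin n))) :=
  range pathSimplex

/-- The all-ones vector. -/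
def allOnes (n : ℕ) : EuclideanSpace ℝ (Fin n) :=
  WithLp.toLp 2 fun _ => 1

/-- The cube corner at the origin, with vertices `0, e₁, …, eₙ`. -/
def cubeCorner (n : ℕ) : Set (EuclideanSpace ℝ (Fin n)) :=
  insert 0 (range fun i : Fin n => EuclideanSpace.single i (1 : ℝ))

/-- The antipodal of the cube corner: the convex hull of `e₁, …, eₙ` and the all-ones vector. -/
def antipodalSimplex (n : ℕ) : Set (EuclideanSpace ℝ (Fin n)) :=
  insert (allOnes n) (range fun i : Fin n => EuclideanSpace.single i (1 : ℝ))

/-- The embedding of `ℝⁿ` onto the hyperplane `x j = 0` of `ℝⁿ⁺¹` that inserts a zero at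
coordinate `j`. -/
def facetEmbedding {n : ℕ} (j : Fin (n + 1)) (x : EuclideanSpace ℝ (Fin n)) :
    EuclideanSpace ℝ (Fin (n + 1)) :=
  WithLp.toLp 2 (Fin.insertNth (α := fun _ => ℝ) j 0 x)

/-- The triangulation obtained by recursively coning off to the all-ones vector. It consists of the
cube corner at the origin, its antipodal, and, for each facet of the cube through the origin, the
cones to the all-ones vector over the simplices, other than the cube corner, of the copy in that
facet of the triangulation one dimension lower. -/
def coneTriangulation : (n : ℕ) → Set (Set (EuclideanSpace ℝ (Fin n)))
  | 0 => {cubeCorner 0}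
  | 1 => {cubeCorner 1}
  | n + 2 =>
    {cubeCorner (n + 2), antipodalSimplex (n + 2)} ∪
      {S | ∃ j : Fin (n + 2), ∃ R ∈ coneTriangulation (n + 1), R ≠ cubeCorner (n + 1) ∧
        S = insert (allOnes (n + 2)) (facetEmbedding j '' R)}

/-- A symmetry of the cube: an isometry of Euclidean space that maps the unit cube onto itself. -/
def IsCubeSymmetry {n : ℕ}
    (g : EuclideanSpace ℝ (Fin n) ≃ᵃⁱ[ℝ] EuclideanSpace ℝ (Fin n)) : Prop :=
  g '' unitCube n = unitCube n

/-- The image of a set of simplices, given by their vertex sets, under a map. -/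
def mapSimplices {n : ℕ} (g : EuclideanSpace ℝ (Fin n) → EuclideanSpace ℝ (Fin n))
    (T : Set (Set (EuclideanSpace ℝ (Fin n)))) : Set (Set (EuclideanSpace ℝ (Fin n))) :=
  (fun S => g '' S) '' T

end CubeTriangulation

end

noncomputable section

namespace CubeTriangulation

open Set

variable {n : ℕ}

/-! In a nonobtuse simplex every vertex projects orthogonally into the opposite facet
(`IsNonobtuse.projectsInside`), and this passes to faces (`ProjectsInside.diff_singleton`). Every
triangulation has a simplex containing 0 and, for each `j`, a vertex whose last nonzero coordinate
is the `j`-th (`exists_flag`). For such a nonobtuse simplex the altitude from the `j`-th vertex onto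
the face of its predecessors is the vector `e_j`. The foot is then a cube vertex in that face, hence
one of its vertices. So the simplex is spanned by a tree of cube edges, one in each direction
(`exists_tree`). In dimension five this gives 5! trees, and up to cube symmetries six: one for each
tree on six vertices.

A facet not contained in the boundary of the cube has a neighbour on its other side, whose new
vertex again projects into the facet (`exists_neighbor`). Integer inequalities leave at most one
candidate at each facet that is crossed. The path forces its images under adjacent transpositions,
hence the standard triangulation. The star, a cube corner, forces the cone triangulation, and the
spider with legs 1, 1, 3 leads back to a corner. The other three trees lead to a facet without any
admissible neighbour. A triangulation containing another one equals it (`eq_of_subset`), so forcing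
the members determines the triangulation.

Conversely, both triangulations are orbits of explicit simplices under coordinate permutations
(`standardTriangulation_eq`, `coneTriangulation_eq`). Covering need only be checked for decreasing
coordinates, and the face to face property follows from a permutation invariant height function
(`isNonobtuseBinaryTriangulation_permOrbit`). -/

/-! ### Cubes, half-spaces and barycentric coordinates -/

theorem IsBinarySimplex.finite {S : Set (EuclideanSpace ℝ (Fin n))} (hS : IsBinarySimplex S) :
    S.Finite :=
  Set.finite_of_ncard_pos (by rw [hS.ncard_eq]; omega)

theorem cubeVertices_finite (n : ℕ) : (cubeVertices n).Finite := by
  refine (Set.finite_range fun f : Fin n → Bool =>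
    (WithLp.toLp 2 fun i => if f i then (1 : ℝ) else 0 : EuclideanSpace ℝ (Fin n))).subset ?_
  intro x hx
  refine ⟨fun i => decide (x i = 1), ?_⟩
  ext i
  rcases hx i with h | h <;> simp [h]

theorem cubeVertices_subset_unitCube (n : ℕ) : cubeVertices n ⊆ unitCube n := by
  intro x hx i
  rcases hx i with h | h <;> simp [h]

theorem convex_unitCube (n : ℕ) : Convex ℝ (unitCube n) := by
  intro x hx y hy a b ha hb hab i
  have := (convex_Icc (0 : ℝ) 1) (hx i) (hy i) ha hb hab
  simpa using this

theorem inner_le_of_mem_convexHull {E : Type*} [NormedAddCommGroup E] [InnerProductSpace ℝ E]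
    {S : Set E} {u : E} {c : ℝ} (h : ∀ x ∈ S, inner ℝ u x ≤ c) {z : E}
    (hz : z ∈ convexHull ℝ S) : inner ℝ u z ≤ c := by
  refine convexHull_min (t := {x | inner ℝ u x ≤ c}) h ?_ hz
  exact convex_halfSpace_le (f := fun x => inner ℝ u x) (innerₛₗ ℝ u).isLinear c

theorem le_inner_of_mem_convexHull {E : Type*} [NormedAddCommGroup E] [InnerProductSpace ℝ E]
    {S : Set E} {u : E} {c : ℝ} (h : ∀ x ∈ S, c ≤ inner ℝ u x) {z : E}
    (hz : z ∈ convexHull ℝ S) : c ≤ inner ℝ u z := by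
  refine convexHull_min (t := {x | c ≤ inner ℝ u x}) h ?_ hz
  exact convex_halfSpace_ge (f := fun x => inner ℝ u x) (innerₛₗ ℝ u).isLinear c

theorem inner_eq_of_mem_convexHull {E : Type*} [NormedAddCommGroup E] [InnerProductSpace ℝ E]
    {S : Set E} {u : E} {c : ℝ} (h : ∀ x ∈ S, inner ℝ u x = c) {z : E}
    (hz : z ∈ convexHull ℝ S) : inner ℝ u z = c :=
  le_antisymm (inner_le_of_mem_convexHull (fun x hx => (h x hx).le) hz)
    (le_inner_of_mem_convexHull (fun x hx => (h x hx).ge) hz)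

/-- The vertices of a binary simplex form an affine basis. -/
def IsBinarySimplex.affineBasis {S : Set (EuclideanSpace ℝ (Fin n))} (hS : IsBinarySimplex S) :
    AffineBasis S ℝ (EuclideanSpace ℝ (Fin n)) where
  toFun := (↑)
  ind' := hS.affineIndependent
  tot' := by
    have := hS.finite.fintype
    rw [hS.affineIndependent.affineSpan_eq_top_iff_card_eq_finrank_add_one]
    rw [← Nat.card_eq_fintype_card, Nat.card_coe_set_eq, hS.ncard_eq]
    simp

/-- The barycentric coordinate of a vertex of a binary simplex. -/
theorem IsBinarySimplex.exists_coord {S : Set (EuclideanSpace ℝ (Fin n))}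
    (hS : IsBinarySimplex S) {p : EuclideanSpace ℝ (Fin n)} (hp : p ∈ S) :
    ∃ β : EuclideanSpace ℝ (Fin n) →ᵃ[ℝ] ℝ, β p = 1 ∧ ∀ x ∈ S, x ≠ p → β x = 0 := by
  refine ⟨hS.affineBasis.coord ⟨p, hp⟩, hS.affineBasis.coord_apply_eq ⟨p, hp⟩, fun x hx hxp => ?_⟩
  exact hS.affineBasis.coord_apply_ne (i := ⟨p, hp⟩) (j := ⟨x, hx⟩)
    (by simpa [Subtype.ext_iff, eq_comm] using hxp)

theorem affineMap_eq_zero_of_mem_convexHull {E : Type*} [AddCommGroup E] [Module ℝ E]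
    (β : E →ᵃ[ℝ] ℝ) {X : Set E} (h : ∀ x ∈ X, β x = 0) {z : E} (hz : z ∈ convexHull ℝ X) :
    β z = 0 := by
  have : Convex ℝ (β ⁻¹' {0}) := (convex_singleton (0 : ℝ)).affine_preimage β
  exact convexHull_min (t := β ⁻¹' {0}) h this hz

theorem IsBinarySimplex.exists_weights {S : Set (EuclideanSpace ℝ (Fin n))}
    (hS : IsBinarySimplex S) [Fintype S] (x : EuclideanSpace ℝ (Fin n)) :
    ∃ w : S → ℝ, ∑ i, w i = 1 ∧ ∑ i, w i • (i : EuclideanSpace ℝ (Fin n)) = x :=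
  ⟨fun i => hS.affineBasis.coord i x, hS.affineBasis.sum_coord_apply_eq_one x,
    hS.affineBasis.linear_combination_coord_eq_self x⟩

theorem sub_eq_sum_smul_sub {S : Set (EuclideanSpace ℝ (Fin n))} [Fintype S] {w : S → ℝ}
    {x : EuclideanSpace ℝ (Fin n)} (h1 : ∑ i, w i = 1)
    (hx : ∑ i, w i • (i : EuclideanSpace ℝ (Fin n)) = x) (p : EuclideanSpace ℝ (Fin n)) :
    x - p = ∑ i, w i • ((i : EuclideanSpace ℝ (Fin n)) - p) := by
  simp only [smul_sub, Finset.sum_sub_distrib, ← Finset.sum_smul, h1, hx, one_smul]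

/-- A vector orthogonal to all edges of a binary simplex vanishes. -/
theorem IsBinarySimplex.eq_zero_of_inner {S : Set (EuclideanSpace ℝ (Fin n))}
    (hS : IsBinarySimplex S) {p : EuclideanSpace ℝ (Fin n)} {d : EuclideanSpace ℝ (Fin n)}
    (hd : ∀ x ∈ S, inner ℝ d (x - p) = 0) : d = 0 := by
  have := hS.finite.fintype
  obtain ⟨w, h1, hw⟩ := hS.exists_weights (p + d)
  have := sub_eq_sum_smul_sub h1 hw p
  rw [add_sub_cancel_left] at this
  rw [← inner_self_eq_zero (𝕜 := ℝ)]
  nth_rewrite 2 [this]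
  rw [inner_sum]
  exact Finset.sum_eq_zero fun i _ => by rw [inner_smul_right, hd _ i.2, mul_zero]

/-! ### Altitudes of nonobtuse simplices -/

/-- Every vertex projects orthogonally into the opposite facet. -/
def ProjectsInside {E : Type*} [NormedAddCommGroup E] [InnerProductSpace ℝ E] (S : Set E) : Prop :=
  ∀ p ∈ S, ∃ z ∈ convexHull ℝ (S \ {p}), ∀ x ∈ S \ {p}, ∀ y ∈ S \ {p}, inner ℝ (p - z) (x - y) = 0

/-- If the foot of `p` is `a q + (1 - a) r` and that of `q` is `b p + (1 - b) r'`, with `r`, `r'` in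
the hull of the remaining vertices, then eliminating `q` from the two altitudes gives the foot of
`p` in the smaller face, with denominator `1 - a b`. -/
theorem ProjectsInside.diff_singleton {E : Type*} [NormedAddCommGroup E] [InnerProductSpace ℝ E]
    {S : Set E} (hS : ProjectsInside S) {q : E} (hq : q ∈ S) (hne : (S \ {q}).Nontrivial) :
    ProjectsInside (S \ {q}) := by
  intro p hp
  have hpq : p ≠ q := hp.2
  set R := (S \ {q}) \ {p} with hR
  obtain ⟨r₀, hr₀⟩ : R.Nonempty := by
    obtain ⟨r, hr, hrp⟩ := hne.exists_ne p
    exact ⟨r, hr, hrp⟩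
  have e1 : S \ {p} = insert q R := by
    ext x; by_cases hx : x = q
    · simp [hx, hq, hpq.symm]
    · simp [hR, hx]
  have e2 : S \ {q} = insert p R := by
    ext x; by_cases hx : x = p
    · simp [hx, hp.1, hpq]
    · simp [hR, hx]
  obtain ⟨z, hz, hzo⟩ := hS p hp.1
  obtain ⟨z', hz', hzo'⟩ := hS q hq
  rw [e1] at hz hzo
  rw [e2] at hz' hzo'
  rw [convexHull_insert ⟨r₀, hr₀⟩, mem_convexJoin] at hz hz'
  obtain ⟨q', hq', r, hr, a, w, ha, hw, haw, hzz⟩ := hz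
  obtain ⟨p', hp', r', hr', b, v, hb, hv, hbv, hzz'⟩ := hz'
  rw [mem_singleton_iff.1 hq'] at hzz
  rw [mem_singleton_iff.1 hp'] at hzz'
  subst hzz hzz'
  obtain rfl : w = 1 - a := by linarith
  obtain rfl : v = 1 - b := by linarith
  have hab : a * b < 1 := by
    have ha1 : a ≤ 1 := by linarith
    have hb1 : b ≤ 1 := by linarith
    have : a * b ≤ 1 := mul_le_one₀ ha1 hb hb1
    rcases this.lt_or_eq with h | h
    · exact h
    -- If `a = b = 1`, each foot is the other vertex, and the triangle with `r₀` would have right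
    -- angles at both `p` and `q`.
    · exfalso
      have ha' : a = 1 := by nlinarith
      have hb' : b = 1 := by nlinarith
      subst ha' hb'
      have h1 := hzo q (mem_insert _ _) r₀ (mem_insert_of_mem _ hr₀)
      have h2 := hzo' p (mem_insert _ _) r₀ (mem_insert_of_mem _ hr₀)
      simp only [one_smul, sub_self, zero_smul, add_zero] at h1 h2
      have h3 : inner ℝ (p - q) (p - q) = 0 := by
        have : p - q = (p - r₀) - (q - r₀) := by abel
        nth_rewrite 2 [this]
        rw [inner_sub_right, h1, ← neg_sub q p, inner_neg_left, h2]; simp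
      rw [inner_self_eq_zero, sub_eq_zero] at h3
      exact hpq h3
  have hc : 0 < 1 - a * b := by linarith
  refine ⟨((1 - a) / (1 - a * b)) • r + (a * (1 - b) / (1 - a * b)) • r', ?_, ?_⟩
  · refine (convex_convexHull ℝ R) hr hr' (div_nonneg hw hc.le)
      (div_nonneg (mul_nonneg ha hv) hc.le) ?_
    field_simp; ring
  · intro x hx y hy
    have h1 := hzo x (mem_insert_of_mem _ hx) y (mem_insert_of_mem _ hy)
    have h2 := hzo' x (mem_insert_of_mem _ hx) y (mem_insert_of_mem _ hy)
    have key : p - (((1 - a) / (1 - a * b)) • r + (a * (1 - b) / (1 - a * b)) • r') =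
        (1 / (1 - a * b)) • ((p - (a • q + (1 - a) • r)) + a • (q - (b • p + (1 - b) • r'))) := by
      match_scalars <;> field_simp <;> ring
    rw [key, inner_smul_left, inner_add_left, inner_smul_left, h1, h2]; simp

theorem IsNonobtuse.inner_nonpos {S : Set (EuclideanSpace ℝ (Fin n))} (hS : IsNonobtuse S)
    {p q u v : EuclideanSpace ℝ (Fin n)} (hp : p ∈ S) (hq : q ∈ S) (hpq : p ≠ q)
    (hu : IsOutwardNormal S p u) (hv : IsOutwardNormal S q v) : inner ℝ u v ≤ 0 := by
  have h := hS p hp q hq hpq _ ⟨u, v, hu, hv, rfl⟩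
  by_contra hc
  push Not at hc
  have h2 : InnerProductGeometry.angle u v < Real.pi / 2 := by
    rw [InnerProductGeometry.angle, Real.arccos_lt_pi_div_two]
    exact div_pos hc (mul_pos (norm_pos_iff.2 hu.1) (norm_pos_iff.2 hv.1))
  linarith

/-- The foot of the perpendicular from a vertex of a binary simplex to the opposite facet. -/
theorem IsBinarySimplex.exists_foot {S : Set (EuclideanSpace ℝ (Fin n))} (hS : IsBinarySimplex S)
    {p : EuclideanSpace ℝ (Fin n)} (hp : p ∈ S) (hne : (S \ {p}).Nonempty) :
    ∃ z ∈ affineSpan ℝ (S \ {p}), IsOutwardNormal S p (z - p) ∧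
      ∀ x ∈ S \ {p}, ∀ y ∈ S \ {p}, inner ℝ (p - z) (x - y) = 0 := by
  have : Nonempty (affineSpan ℝ (S \ {p})) := by
    obtain ⟨x, hx⟩ := hne
    exact ⟨⟨x, subset_affineSpan ℝ _ hx⟩⟩
  set z := (EuclideanGeometry.orthogonalProjection (affineSpan ℝ (S \ {p})) p :
    EuclideanSpace ℝ (Fin n)) with hz
  have hzm : z ∈ affineSpan ℝ (S \ {p}) := EuclideanGeometry.orthogonalProjection_mem p
  have horth := EuclideanGeometry.vsub_orthogonalProjection_mem_direction_orthogonal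
    (affineSpan ℝ (S \ {p})) p
  rw [← hz, Submodule.mem_orthogonal'] at horth
  have ho : ∀ x ∈ affineSpan ℝ (S \ {p}), ∀ y ∈ affineSpan ℝ (S \ {p}),
      inner ℝ (p - z) (x - y) = 0 := fun x hx y hy =>
    horth _ (AffineSubspace.vsub_mem_direction hx hy)
  have hpz : z ≠ p := by
    intro h
    rw [h] at hzm
    have := hS.affineIndependent.notMem_affineSpan_sdiff ⟨p, hp⟩ univ
    apply this
    have e : ((↑) : S → EuclideanSpace ℝ (Fin n)) '' (univ \ {⟨p, hp⟩}) = S \ {p} := by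
      ext x; simp
    rw [e]; exact hzm
  have hss := subset_affineSpan ℝ (S \ {p})
  refine ⟨z, hzm, ⟨sub_ne_zero.2 hpz, fun x hx y hy => ?_, fun x hx => ?_⟩, fun x hx y hy =>
    ho x (hss hx) y (hss hy)⟩
  · rw [← neg_sub, inner_neg_left, ho x (hss hx) y (hss hy), neg_zero]
  · have h1 := ho z hzm x (hss hx)
    have h2 : p - x = (p - z) + (z - x) := by abel
    rw [h2, ← neg_sub p z, inner_neg_left, inner_add_right, h1, add_zero, Left.neg_neg_iff]
    exact real_inner_self_pos.2 (sub_ne_zero.2 hpz.symm)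

/-- Pairing an outward normal at `q` with the outward normal `z - p` isolates the barycentric
coordinate of the foot `z` at `q`, times a negative number. Nonobtuseness makes the pairing
nonpositive, so the coordinate is nonnegative. -/
theorem IsNonobtuse.projectsInside {S : Set (EuclideanSpace ℝ (Fin n))} (hS : IsNonobtuse S)
    (hb : IsBinarySimplex S) (hn : 0 < n) : ProjectsInside S := by
  have hne : ∀ p ∈ S, (S \ {p}).Nonempty := by
    intro p hp
    apply Set.nonempty_of_ncard_ne_zero
    rw [Set.ncard_sdiff_singleton_of_mem hp, hb.ncard_eq]; omega
  intro p hp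
  obtain ⟨z, hz, hu, ho⟩ := hb.exists_foot hp (hne p hp)
  refine ⟨z, ?_, ho⟩
  have := hb.finite.fintype
  set B := hb.affineBasis with hB
  have hBi : ∀ i : S, B i = i := fun i => rfl
  have hcp : B.coord ⟨p, hp⟩ z = 0 := by
    have h0 : ∀ x ∈ affineSpan ℝ (S \ {p}), B.coord ⟨p, hp⟩ x = 0 := by
      intro x hx
      have : affineSpan ℝ (S \ {p}) ≤ (affineSpan ℝ {(0 : ℝ)}).comap (B.coord ⟨p, hp⟩) := by
        rw [affineSpan_le]
        intro y hy
        have := B.coord_apply_ne (i := ⟨p, hp⟩) (j := ⟨y, hy.1⟩)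
          (by simpa [Subtype.ext_iff, eq_comm] using hy.2)
        rw [hBi] at this
        simp [this]
      simpa using this hx
    exact h0 z hz
  have hsum := B.sum_coord_apply_eq_one z
  have hlin : ∑ i, B.coord i z • (i : EuclideanSpace ℝ (Fin n)) = z :=
    B.linear_combination_coord_eq_self z
  have hnonneg : ∀ i, 0 ≤ B.coord i z := by
    intro i
    by_cases hip : i = ⟨p, hp⟩
    · rw [hip, hcp]
    obtain ⟨q, hq⟩ := i
    have hqp : q ≠ p := by simpa [Subtype.ext_iff] using hip
    obtain ⟨z', -, hv, -⟩ := hb.exists_foot hq (hne q hq)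
    set v := z' - q
    have h1 := hS.inner_nonpos hq hp hqp hv hu
    rw [sub_eq_sum_smul_sub hsum hlin p, inner_sum, Finset.sum_eq_single ⟨q, hq⟩] at h1
    · rw [inner_smul_right] at h1
      have h2 := hv.2.2 p ⟨hp, hqp.symm⟩
      by_contra hc
      push Not at hc
      nlinarith
    · intro j _ hj
      rw [inner_smul_right, hv.2.1 j ⟨j.2, ?_⟩ p ⟨hp, hqp.symm⟩, mul_zero]
      simpa [Subtype.ext_iff] using hj
    · simp
  rw [← hlin, ← Finset.sum_erase (a := ⟨p, hp⟩) _ (by rw [hcp, zero_smul])]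
  refine (convex_convexHull ℝ _).sum_mem (fun i _ => hnonneg i) ?_ fun i hi => ?_
  · rw [Finset.sum_erase (f := fun i => B.coord i z) _ hcp, hsum]
  · refine subset_convexHull ℝ _ ⟨i.2, ?_⟩
    simpa [Subtype.ext_iff] using hi

/-! ### Local structure of triangulations and neighbours across facets -/

theorem IsBinaryTriangulation.finite {T : Set (Set (EuclideanSpace ℝ (Fin n)))}
    (hT : IsBinaryTriangulation T) : T.Finite :=
  (cubeVertices_finite n).powerset.subset fun S hS => (hT.isBinarySimplex S hS).subset_cubeVertices

theorem IsBinaryTriangulation.convexHull_subset {T : Set (Set (EuclideanSpace ℝ (Fin n)))}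
    (hT : IsBinaryTriangulation T) {S : Set (EuclideanSpace ℝ (Fin n))} (hS : S ∈ T) :
    convexHull ℝ S ⊆ unitCube n :=
  hT.cover ▸ subset_biUnion_of_mem (u := fun S => convexHull ℝ S) hS

theorem IsBinaryTriangulation.exists_mem {T : Set (Set (EuclideanSpace ℝ (Fin n)))}
    (hT : IsBinaryTriangulation T) {x : EuclideanSpace ℝ (Fin n)} (hx : x ∈ unitCube n) :
    ∃ S ∈ T, x ∈ convexHull ℝ S := by
  rw [← hT.cover] at hx
  simpa using hx

/-- Near a point there are only simplices that contain this point. -/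
theorem IsBinaryTriangulation.exists_ball {T : Set (Set (EuclideanSpace ℝ (Fin n)))}
    (hT : IsBinaryTriangulation T) (x : EuclideanSpace ℝ (Fin n)) :
    ∃ ε > 0, ∀ y, dist y x < ε → ∀ S ∈ T, y ∈ convexHull ℝ S → x ∈ convexHull ℝ S := by
  have hcl : IsClosed (⋃ S ∈ {S ∈ T | x ∉ convexHull ℝ S}, convexHull ℝ S) :=
    (hT.finite.subset (sep_subset _ _)).isClosed_biUnion fun S hS =>
      (hT.isBinarySimplex S hS.1).finite.isClosed_convexHull ℝ
  have hx : x ∈ (⋃ S ∈ {S ∈ T | x ∉ convexHull ℝ S}, convexHull ℝ S)ᶜ := by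
    simp only [mem_compl_iff, mem_iUnion, not_exists]
    exact fun S hS h => hS.2 h
  obtain ⟨ε, hε, h⟩ := Metric.isOpen_iff.1 hcl.isOpen_compl x hx
  refine ⟨ε, hε, fun y hy S hS hyS => ?_⟩
  by_contra hc
  exact h hy (mem_biUnion (show S ∈ {S ∈ T | x ∉ convexHull ℝ S} from ⟨hS, hc⟩) hyS)

/-- A point of the relative interior of a face lies only in simplices that share this face. -/
theorem IsBinaryTriangulation.subset_of_mem {T : Set (Set (EuclideanSpace ℝ (Fin n)))}
    (hT : IsBinaryTriangulation T) {S S' : Set (EuclideanSpace ℝ (Fin n))} (hS : S ∈ T)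
    (hS' : S' ∈ T) {s : Finset (EuclideanSpace ℝ (Fin n))} (hs : ↑s ⊆ S)
    (hb : s.centerMass (fun _ => (1 : ℝ)) id ∈ convexHull ℝ S') : ↑s ⊆ S' := by
  intro y hy
  have hne : s.Nonempty := ⟨y, hy⟩
  have hcard : (0 : ℝ) < s.card := by exact_mod_cast hne.card_pos
  set b := s.centerMass (fun _ => (1 : ℝ)) id with hbdef
  have hbs : b ∈ convexHull ℝ (s : Set (EuclideanSpace ℝ (Fin n))) :=
    s.centerMass_id_mem_convexHull (fun _ _ => zero_le_one) (by simpa using hcard)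
  have hbi : b ∈ convexHull ℝ (S ∩ S') := by
    rw [← hT.face_to_face S hS S' hS']
    exact ⟨convexHull_mono hs hbs, hb⟩
  by_contra hyS'
  -- The coordinate at the missing vertex `y` vanishes on the common face, but is `1 / s.card` at
  -- the barycenter.
  obtain ⟨β, h1, h0⟩ := (hT.isBinarySimplex S hS).exists_coord (hs hy)
  have hb0 : β b = 0 := by
    refine affineMap_eq_zero_of_mem_convexHull β (fun x hx => h0 x hx.1 ?_) hbi
    rintro rfl
    exact hyS' hx.2
  have hb1 : β b = (s.card : ℝ)⁻¹ := by
    have hw : ∑ i ∈ s, (s.card : ℝ)⁻¹ = 1 := by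
      rw [Finset.sum_const, nsmul_eq_mul, mul_inv_cancel₀ hcard.ne']
    have e : b = ∑ i ∈ s, (s.card : ℝ)⁻¹ • id i := by
      simp [hbdef, Finset.centerMass, Finset.smul_sum]
    rw [e, ← s.affineCombination_eq_linear_combination id _ hw, Finset.map_affineCombination _ _ _ hw,
      s.affineCombination_eq_linear_combination _ _ hw, Finset.sum_eq_single y]
    · simp [h1]
    · intro z hz hzy
      simp [h0 z (hs hz) hzy]
    · exact fun h => absurd hy h
  rw [hb1] at hb0
  exact (inv_pos.2 hcard).ne' hb0

/-- A triangulation that is contained in another one is equal to it. -/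
theorem IsBinaryTriangulation.eq_of_subset {T T₀ : Set (Set (EuclideanSpace ℝ (Fin n)))}
    (hT : IsBinaryTriangulation T) (hT₀ : IsBinaryTriangulation T₀) (h : T₀ ⊆ T) : T = T₀ := by
  refine Subset.antisymm (fun S hS => ?_) h
  have hSb := hT.isBinarySimplex S hS
  obtain ⟨s, rfl⟩ := hSb.finite.exists_finset_coe
  have hne : (0 : ℝ) < ∑ _i ∈ s, (1 : ℝ) := by
    have := hSb.ncard_eq
    rw [ncard_coe_finset] at this
    rw [Finset.sum_const, this]; positivity
  have hb : s.centerMass (fun _ => (1 : ℝ)) id ∈ convexHull ℝ (s : Set (EuclideanSpace ℝ (Fin n))) :=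
    s.centerMass_id_mem_convexHull (fun _ _ => zero_le_one) hne
  -- The barycenter of `s` lies in a member of `T₀`, which also belongs to `T`; that member must
  -- contain all of `s`.
  obtain ⟨S', hS', hbS'⟩ := hT₀.exists_mem (hT.convexHull_subset hS hb)
  have hsub := hT.subset_of_mem hS (h hS') subset_rfl hbS'
  have hb' := hT₀.isBinarySimplex S' hS'
  have : (s : Set (EuclideanSpace ℝ (Fin n))) = S' :=
    eq_of_subset_of_ncard_le hsub (by rw [hSb.ncard_eq, hb'.ncard_eq]) hb'.finite
  rwa [this]

/-- Across a facet in the interior of the cube, a nonobtuse binary triangulation has another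
simplex, whose additional vertex projects into this facet. -/
theorem IsNonobtuseBinaryTriangulation.exists_neighbor
    {T : Set (Set (EuclideanSpace ℝ (Fin n)))} (hT : IsNonobtuseBinaryTriangulation T)
    {F : Set (EuclideanSpace ℝ (Fin n))} {p ν : EuclideanSpace ℝ (Fin n)} {c : ℝ}
    (hS : insert p F ∈ T) (hn : 0 < n) (hF : ∀ x ∈ F, inner ℝ ν x = c) (hp : inner ℝ ν p < c)
    (h0 : ∀ i, ∃ x ∈ F, x i = 0) (h1 : ∀ i, ∃ x ∈ F, x i = 1) :
    ∃ q ∈ cubeVertices n, c < inner ℝ ν q ∧ insert q F ∈ T ∧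
      ∃ t : ℝ, 0 < t ∧ q - t • ν ∈ convexHull ℝ F := by
  have hSb := hT.1.isBinarySimplex _ hS
  have hpF : p ∉ F := fun h => hp.ne (hF p h)
  obtain ⟨s, rfl⟩ := (hSb.finite.subset (subset_insert p F)).exists_finset_coe
  have hcardF : s.card = n := by
    have := hSb.ncard_eq
    rw [ncard_insert_of_notMem hpF s.finite_toSet, ncard_coe_finset] at this
    omega
  obtain ⟨f, hfs⟩ : s.Nonempty := Finset.card_pos.1 (by omega)
  have hcard : (0 : ℝ) < s.card := by exact_mod_cast (by omega : 0 < s.card)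
  set b := s.centerMass (fun _ => (1 : ℝ)) id with hb
  have hbs : b ∈ convexHull ℝ (s : Set (EuclideanSpace ℝ (Fin n))) :=
    s.centerMass_id_mem_convexHull (fun _ _ => zero_le_one) (by simpa using hcard)
  have hbi : ∀ i, b i = (s.card : ℝ)⁻¹ * ∑ x ∈ s, x i := by
    intro i
    simp [hb, Finset.centerMass, Finset.mul_sum]
  have hcube : ∀ x ∈ s, ∀ i, 0 ≤ x i ∧ x i ≤ 1 := fun x hx i =>
    cubeVertices_subset_unitCube n (hSb.subset_cubeVertices (mem_insert_of_mem p hx)) i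
  -- Both values 0 and 1 occur on the facet in each coordinate, so its barycenter is interior to the
  -- cube and a small step along `ν` stays inside.
  have hb0 : ∀ i, 0 < b i := by
    intro i
    rw [hbi]
    refine mul_pos (inv_pos.2 hcard) (Finset.sum_pos' (fun x hx => (hcube x hx i).1) ?_)
    obtain ⟨x, hx, hxi⟩ := h1 i
    exact ⟨x, hx, by rw [hxi]; exact one_pos⟩
  have hb1 : ∀ i, b i < 1 := by
    intro i
    rw [hbi, inv_mul_lt_iff₀ hcard, mul_one]
    have : ∑ x ∈ s, x i < ∑ x ∈ s, (1 : ℝ) := by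
      refine Finset.sum_lt_sum (fun x hx => (hcube x hx i).2) ?_
      obtain ⟨x, hx, hxi⟩ := h0 i
      exact ⟨x, hx, by rw [hxi]; exact one_pos⟩
    simpa using this
  obtain ⟨ε, hε, hball⟩ := hT.1.exists_ball b
  have hν : 0 < inner ℝ ν ν := by
    refine real_inner_self_pos.2 ?_
    rintro rfl
    rw [inner_zero_left] at hp
    have := hF f hfs
    rw [inner_zero_left] at this
    linarith
  obtain ⟨δ, hδ, hδε, hδc⟩ : ∃ δ : ℝ, 0 < δ ∧ dist (b + δ • ν) b < ε ∧ b + δ • ν ∈ unitCube n := by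
    have hcont : Filter.Tendsto (fun δ : ℝ => b + δ • ν) (nhdsWithin 0 (Ioi 0)) (nhds b) := by
      have : Continuous fun δ : ℝ => b + δ • ν := by fun_prop
      have h := this.tendsto 0
      rw [zero_smul, add_zero] at h
      exact h.mono_left nhdsWithin_le_nhds
    have hi : ∀ i, ∀ᶠ δ in nhdsWithin (0 : ℝ) (Ioi 0), (b + δ • ν) i ∈ Ioo (0 : ℝ) 1 := by
      intro i
      have hc : Continuous fun x : EuclideanSpace ℝ (Fin n) => x i := by fun_prop
      exact ((hc.tendsto b).comp hcont).eventually (Ioo_mem_nhds (hb0 i) (hb1 i))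
    obtain ⟨δ, ⟨h2, h3⟩, h4⟩ := ((hcont.eventually (Metric.ball_mem_nhds b hε)).and
      (Filter.eventually_all.2 hi)).and self_mem_nhdsWithin |>.exists
    exact ⟨δ, h4, h2, fun i => Ioo_subset_Icc_self (h3 i)⟩
  obtain ⟨S', hS', hyS'⟩ := hT.1.exists_mem hδc
  have hFS' : (s : Set (EuclideanSpace ℝ (Fin n))) ⊆ S' :=
    hT.1.subset_of_mem hS hS' (subset_insert _ _) (hball _ hδε S' hS' hyS')
  have hSb' := hT.1.isBinarySimplex _ hS'
  obtain ⟨q, hqF, rfl⟩ : ∃ q, q ∉ (s : Set (EuclideanSpace ℝ (Fin n))) ∧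
      insert q (s : Set (EuclideanSpace ℝ (Fin n))) = S' := by
    have h : (S' \ s).ncard = 1 := by
      rw [ncard_sdiff hFS' s.finite_toSet, hSb'.ncard_eq, ncard_coe_finset, hcardF]; omega
    obtain ⟨q, hq⟩ := ncard_eq_one.1 h
    have hq' : q ∈ S' \ s := hq ▸ mem_singleton q
    refine ⟨q, hq'.2, ?_⟩
    rw [← singleton_union, ← hq, sdiff_union_of_subset hFS']
  have hbν : inner ℝ ν b = c := inner_eq_of_mem_convexHull hF hbs
  have hq : c < inner ℝ ν q := by
    by_contra hc
    push Not at hc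
    have := inner_le_of_mem_convexHull (u := ν) (c := c) (fun x hx => by
      rcases hx with rfl | hx
      · exact hc
      · exact (hF x hx).le) hyS'
    rw [inner_add_right, inner_smul_right, hbν] at this
    nlinarith
  refine ⟨q, hSb'.subset_cubeVertices (mem_insert _ _), hq, hS', ?_⟩
  obtain ⟨z, hz, ho⟩ := (hT.2 _ hS').projectsInside hSb' hn q (mem_insert _ _)
  rw [insert_sdiff_of_mem _ (mem_singleton q), sdiff_singleton_eq_self hqF] at hz ho
  have hzν : inner ℝ ν z = c := inner_eq_of_mem_convexHull hF hz
  have hpf : inner ℝ ν (p - f) < 0 := by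
    rw [inner_sub_right, hF f hfs]; linarith
  -- Both `q - z` and `ν` are orthogonal to the facet, which has codimension one, so they are
  -- parallel; testing against `p - f` gives the factor.
  set t := inner ℝ (q - z) (p - f) / inner ℝ ν (p - f) with ht
  have hd : (q - z) - t • ν = 0 := by
    refine hSb.eq_zero_of_inner (p := f) fun x hx => ?_
    rw [inner_sub_left, inner_smul_left]
    rcases hx with rfl | hx
    · rw [ht]
      simp only [conj_trivial]
      field_simp [hpf.ne]
      ring
    · rw [ho x hx f hfs, inner_sub_right, hF x hx, hF f hfs]; simp
  have hzt : q - t • ν = z := by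
    rw [sub_sub, add_comm, ← sub_sub, sub_eq_zero] at hd
    exact hd
  refine ⟨t, ?_, hzt ▸ hz⟩
  have : inner ℝ ν (q - t • ν) = c := by rw [hzt, hzν]
  rw [inner_sub_right, inner_smul_right] at this
  by_contra hc
  push Not at hc
  nlinarith

/-! ### Lifting by heights, and extremality of cube vertices -/

/-- The points of a convex hull at which an affine function attains its maximum are in the convex
hull of the generators with this property. -/
theorem mem_convexHull_of_affineMap_eq_zero {E : Type*} [AddCommGroup E] [Module ℝ E]
    (f : E →ᵃ[ℝ] ℝ) {S : Set E} (h : ∀ x ∈ S, f x ≤ 0) {x : E} (hx : x ∈ convexHull ℝ S)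
    (hfx : f x = 0) : x ∈ convexHull ℝ {y ∈ S | f y = 0} := by
  obtain ⟨ι, _, w, z, hw0, hw1, hz, rfl⟩ := mem_convexHull_iff_exists_fintype.1 hx
  rw [← Finset.affineCombination_eq_linear_combination _ _ _ hw1,
    Finset.map_affineCombination _ _ _ hw1,
    Finset.affineCombination_eq_linear_combination _ _ _ hw1] at hfx
  have hfi : ∀ i, w i * f (z i) = 0 := by
    have := (Finset.sum_eq_zero_iff_of_nonpos (s := Finset.univ)
      (f := fun i => w i * f (z i)) fun i _ =>
        mul_nonpos_of_nonneg_of_nonpos (hw0 i) (h _ (hz i))).1 (by simpa using hfx)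
    exact fun i => this i (Finset.mem_univ i)
  rw [← Finset.sum_filter_of_ne (p := fun i => w i ≠ 0)]
  · refine (convex_convexHull ℝ _).sum_mem (fun i _ => hw0 i) ?_ fun i hi => ?_
    · rw [Finset.sum_filter_ne_zero, hw1]
    · refine subset_convexHull ℝ _ ⟨hz i, ?_⟩
      exact (mul_eq_zero.1 (hfi i)).resolve_left (by simpa using hi)
  · intro i _ hi h0
    exact hi (by rw [h0, zero_smul])

/-- Simplices above which a function on the vertices is affine, and strictly larger than this affine
function at all other vertices, meet face to face. -/
theorem convexHull_inter_of_height {E : Type*} [AddCommGroup E] [Module ℝ E] {V S S' : Set E}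
    (ω : E → ℝ) (hS : S ⊆ V) (hS' : S' ⊆ V) (f f' : E →ᵃ[ℝ] ℝ)
    (hf : ∀ x ∈ V, f x ≤ ω x) (hfe : ∀ x ∈ V, f x = ω x ↔ x ∈ S)
    (hf' : ∀ x ∈ V, f' x ≤ ω x) (hfe' : ∀ x ∈ V, f' x = ω x ↔ x ∈ S') :
    convexHull ℝ S ∩ convexHull ℝ S' = convexHull ℝ (S ∩ S') := by
  refine Subset.antisymm ?_ (subset_inter (convexHull_mono inter_subset_left)
    (convexHull_mono inter_subset_right))
  rintro x ⟨hx, hx'⟩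
  -- The difference `f' - f` is nonpositive on `S` and nonnegative on `S'`, so it vanishes where the
  -- hulls meet; only vertices at which both functions equal `ω` contribute to such a point.
  have h1 : ∀ y ∈ S, (f' - f) y ≤ 0 := fun y hy => by
    have := hf' y (hS hy)
    rw [← (hfe y (hS hy)).2 hy] at this
    simpa using this
  have h2 : ∀ y ∈ S', 0 ≤ (f' - f) y := fun y hy => by
    have := hf y (hS' hy)
    rw [← (hfe' y (hS' hy)).2 hy] at this
    simpa using this
  have h3 : (f' - f) x ≤ 0 :=
    convexHull_min (t := (f' - f) ⁻¹' Iic 0) h1 ((convex_Iic 0).affine_preimage _) hx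
  have h4 : 0 ≤ (f' - f) x :=
    convexHull_min (t := (f' - f) ⁻¹' Ici 0) h2 ((convex_Ici 0).affine_preimage _) hx'
  refine convexHull_mono ?_ (mem_convexHull_of_affineMap_eq_zero _ h1 hx (le_antisymm h3 h4))
  rintro y ⟨hy, h0⟩
  refine ⟨hy, (hfe' y (hS hy)).1 ?_⟩
  rw [← (hfe y (hS hy)).2 hy]
  simpa [sub_eq_zero] using h0

/-- The functional with coefficients `1 - 2 v i` exceeds its value at `v` by the number of differing
coordinates, so it separates `v` from all other cube vertices. -/
theorem mem_of_mem_convexHull_of_cubeVertices {S : Set (EuclideanSpace ℝ (Fin n))}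
    (hS : S ⊆ cubeVertices n) {v : EuclideanSpace ℝ (Fin n)} (hv : v ∈ cubeVertices n)
    (h : v ∈ convexHull ℝ S) : v ∈ S := by
  by_contra hvS
  set a : EuclideanSpace ℝ (Fin n) := WithLp.toLp 2 fun i => 1 - 2 * v i with ha
  have := le_inner_of_mem_convexHull (u := a) (c := inner ℝ a v + 1) (fun x hx => ?_) h
  · linarith
  obtain ⟨i, hi⟩ : ∃ i, x i ≠ v i := by
    by_contra hc
    push Not at hc
    exact hvS ((PiLp.ext hc : x = v) ▸ hx)
  have hterm : ∀ j, a j * v j ≤ a j * x j := by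
    intro j
    simp only [ha]
    rcases hv j with h | h <;> rcases hS hx j with h' | h' <;> simp [h, h']
  have hi1 : a i * v i + 1 ≤ a i * x i := by
    simp only [ha]
    rcases hv i with h | h <;> rcases hS hx i with h' | h' <;> (simp_all; try norm_num)
  simp only [PiLp.inner_apply, RCLike.inner_apply, conj_trivial]
  rw [← Finset.add_sum_erase _ _ (Finset.mem_univ i),
    ← Finset.add_sum_erase Finset.univ (fun j => x j * a j) (Finset.mem_univ i)]
  have := Finset.sum_le_sum (s := Finset.univ.erase i) fun j _ => hterm j
  simp only [mul_comm (a _)] at this hi1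
  linarith

/-- Vertices of the cube are the points of the cube that are not the midpoint of a segment in it. -/
theorem mem_cubeVertices_iff {x : EuclideanSpace ℝ (Fin n)} : x ∈ cubeVertices n ↔
    x ∈ unitCube n ∧ ∀ y ∈ unitCube n, ∀ z ∈ unitCube n, midpoint ℝ y z = x → y = x := by
  constructor
  · refine fun hx => ⟨cubeVertices_subset_unitCube n hx, fun y hy z hz h => ?_⟩
    ext i
    have h' : (y i + z i) / 2 = x i := by
      rw [← h, midpoint_eq_smul_add]; simp; ring
    have h1 := hy i
    have h2 := hz i
    rw [mem_Icc] at h1 h2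
    rcases hx i with h0 | h0 <;> rw [h0] at h' ⊢ <;> linarith
  · rintro ⟨hx, h⟩ i
    by_contra hc
    push Not at hc
    obtain ⟨h0, h1⟩ := hx i
    have h0' : 0 < x i := lt_of_le_of_ne h0 hc.1.symm
    have h1' : x i < 1 := lt_of_le_of_ne h1 hc.2
    set d := min (x i) (1 - x i) with hd
    have hd0 : 0 < d := lt_min h0' (by linarith)
    have hd1 : d ≤ x i := min_le_left _ _
    have hd2 : d ≤ 1 - x i := min_le_right _ _
    have := h (x + EuclideanSpace.single i d) ?_ (x - EuclideanSpace.single i d) ?_ ?_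
    · have := congrArg (fun y => y i) this
      simp at this
      linarith
    · intro j
      by_cases hj : j = i
      · subst hj; simp; constructor <;> linarith
      · simpa [hj] using hx j
    · intro j
      by_cases hj : j = i
      · subst hj; simp; constructor <;> linarith
      · simpa [hj] using hx j
    · rw [midpoint_eq_smul_add]
      ext j
      simp
      ring

/-! ### Invariance under the symmetries of the cube -/

theorem IsCubeSymmetry.symm {g : EuclideanSpace ℝ (Fin n) ≃ᵃⁱ[ℝ] EuclideanSpace ℝ (Fin n)}
    (hg : IsCubeSymmetry g) : IsCubeSymmetry g.symm := by
  unfold IsCubeSymmetry at *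
  nth_rewrite 1 [← hg]
  rw [← image_comp]
  simp

theorem IsCubeSymmetry.trans {g h : EuclideanSpace ℝ (Fin n) ≃ᵃⁱ[ℝ] EuclideanSpace ℝ (Fin n)}
    (hg : IsCubeSymmetry g) (hh : IsCubeSymmetry h) : IsCubeSymmetry (g.trans h) := by
  unfold IsCubeSymmetry at *
  rw [AffineIsometryEquiv.coe_trans, image_comp, hg, hh]

theorem isCubeSymmetry_of_mapsTo
    {g : EuclideanSpace ℝ (Fin n) ≃ᵃⁱ[ℝ] EuclideanSpace ℝ (Fin n)}
    (h : MapsTo g (unitCube n) (unitCube n)) (h' : MapsTo g.symm (unitCube n) (unitCube n)) :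
    IsCubeSymmetry g :=
  Subset.antisymm h.image_subset fun x hx => ⟨g.symm x, h' hx, g.apply_symm_apply x⟩

theorem IsCubeSymmetry.mem_unitCube_iff
    {g : EuclideanSpace ℝ (Fin n) ≃ᵃⁱ[ℝ] EuclideanSpace ℝ (Fin n)}
    (hg : IsCubeSymmetry g) {x : EuclideanSpace ℝ (Fin n)} : g x ∈ unitCube n ↔ x ∈ unitCube n := by
  unfold IsCubeSymmetry at hg
  nth_rewrite 1 [← hg]
  exact g.injective.mem_set_image

/-- Cube vertices are the extreme points of the cube, and affine maps preserve midpoints. -/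
theorem IsCubeSymmetry.mapsTo_cubeVertices
    {g : EuclideanSpace ℝ (Fin n) ≃ᵃⁱ[ℝ] EuclideanSpace ℝ (Fin n)}
    (hg : IsCubeSymmetry g) {x : EuclideanSpace ℝ (Fin n)} (hx : x ∈ cubeVertices n) :
    g x ∈ cubeVertices n := by
  rw [mem_cubeVertices_iff] at hx ⊢
  refine ⟨hg.mem_unitCube_iff.2 hx.1, fun y hy z hz h => ?_⟩
  have := hx.2 (g.symm y) (hg.symm.mem_unitCube_iff.2 hy) (g.symm z) (hg.symm.mem_unitCube_iff.2 hz)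
    (by
      have e := g.symm.toAffineEquiv.toAffineMap.map_midpoint y z
      rw [h] at e
      simpa using e.symm)
  rw [← this, g.apply_symm_apply]

theorem image_convexHull (g : EuclideanSpace ℝ (Fin n) ≃ᵃⁱ[ℝ] EuclideanSpace ℝ (Fin n))
    (S : Set (EuclideanSpace ℝ (Fin n))) : g '' convexHull ℝ S = convexHull ℝ (g '' S) :=
  g.toAffineEquiv.toAffineMap.image_convexHull S

theorem IsBinarySimplex.image {g : EuclideanSpace ℝ (Fin n) ≃ᵃⁱ[ℝ] EuclideanSpace ℝ (Fin n)}
    (hg : IsCubeSymmetry g) {S : Set (EuclideanSpace ℝ (Fin n))} (hS : IsBinarySimplex S) :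
    IsBinarySimplex (g '' S) where
  subset_cubeVertices := by
    rintro _ ⟨x, hx, rfl⟩
    exact hg.mapsTo_cubeVertices (hS.subset_cubeVertices hx)
  ncard_eq := by rw [ncard_image_of_injective _ g.injective, hS.ncard_eq]
  affineIndependent :=
    (AffineEquiv.affineIndependent_set_of_eq_iff g.toAffineEquiv).2 hS.affineIndependent

theorem IsOutwardNormal.of_image (g : EuclideanSpace ℝ (Fin n) ≃ᵃⁱ[ℝ] EuclideanSpace ℝ (Fin n))
    {S : Set (EuclideanSpace ℝ (Fin n))} {p u : EuclideanSpace ℝ (Fin n)}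
    (h : IsOutwardNormal (g '' S) (g p) u) :
    IsOutwardNormal S p (g.linearIsometryEquiv.symm u) := by
  have hmem : ∀ x ∈ S \ {p}, g x ∈ g '' S \ {g p} := fun x hx =>
    ⟨mem_image_of_mem g hx.1, fun h => hx.2 (g.injective h)⟩
  have hin : ∀ x y, inner ℝ (g.linearIsometryEquiv.symm u) (x - y) = inner ℝ u (g x - g y) := by
    intro x y
    rw [← g.linearIsometryEquiv.inner_map_map, LinearIsometryEquiv.apply_symm_apply]
    have := g.map_vsub x y
    rw [vsub_eq_sub, vsub_eq_sub] at this
    rw [this]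
  refine ⟨by simpa using h.1, fun x hx y hy => ?_, fun x hx => ?_⟩
  · rw [hin]; exact h.2.1 _ (hmem x hx) _ (hmem y hy)
  · rw [hin]; exact h.2.2 _ (hmem x hx)

theorem IsNonobtuse.image (g : EuclideanSpace ℝ (Fin n) ≃ᵃⁱ[ℝ] EuclideanSpace ℝ (Fin n))
    {S : Set (EuclideanSpace ℝ (Fin n))} (hS : IsNonobtuse S) : IsNonobtuse (g '' S) := by
  rintro _ ⟨p, hp, rfl⟩ _ ⟨q, hq, rfl⟩ hpq θ ⟨u, v, hu, hv, rfl⟩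
  refine hS p hp q hq (fun h => hpq (h ▸ rfl)) _ ⟨_, _, hu.of_image g, hv.of_image g, ?_⟩
  rw [← LinearIsometry.angle_map g.linearIsometryEquiv.symm.toLinearIsometry]
  simp

theorem IsNonobtuseBinaryTriangulation.mapSimplices
    {g : EuclideanSpace ℝ (Fin n) ≃ᵃⁱ[ℝ] EuclideanSpace ℝ (Fin n)}
    (hg : IsCubeSymmetry g) {T : Set (Set (EuclideanSpace ℝ (Fin n)))}
    (hT : IsNonobtuseBinaryTriangulation T) :
    IsNonobtuseBinaryTriangulation (mapSimplices g T) := by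
  refine ⟨⟨?_, ?_, ?_⟩, ?_⟩
  · rintro _ ⟨S, hS, rfl⟩
    exact (hT.1.isBinarySimplex S hS).image hg
  · unfold CubeTriangulation.mapSimplices
    rw [biUnion_image]
    simp only [← image_convexHull]
    rw [← image_iUnion₂, hT.1.cover]
    exact hg
  · rintro _ ⟨S, hS, rfl⟩ _ ⟨S', hS', rfl⟩
    simp only [← image_convexHull]
    rw [← image_inter g.injective, hT.1.face_to_face S hS S' hS', image_convexHull,
      image_inter g.injective]
  · rintro _ ⟨S, hS, rfl⟩
    exact (hT.2 S hS).image g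

theorem mapSimplices_trans (g h : EuclideanSpace ℝ (Fin n) ≃ᵃⁱ[ℝ] EuclideanSpace ℝ (Fin n))
    (T : Set (Set (EuclideanSpace ℝ (Fin n)))) :
    mapSimplices (g.trans h) T = mapSimplices h (mapSimplices g T) := by
  unfold mapSimplices
  rw [image_image]
  simp only [AffineIsometryEquiv.coe_trans, image_comp]

theorem mapSimplices_symm_mapSimplices
    (g : EuclideanSpace ℝ (Fin n) ≃ᵃⁱ[ℝ] EuclideanSpace ℝ (Fin n))
    (T : Set (Set (EuclideanSpace ℝ (Fin n)))) :
    mapSimplices g.symm (mapSimplices g T) = T := by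
  rw [← mapSimplices_trans]
  simp [mapSimplices]

theorem mem_mapSimplices_symm {g : EuclideanSpace ℝ (Fin n) ≃ᵃⁱ[ℝ] EuclideanSpace ℝ (Fin n)}
    {T : Set (Set (EuclideanSpace ℝ (Fin n)))} {S : Set (EuclideanSpace ℝ (Fin n))} :
    S ∈ mapSimplices g.symm T ↔ g '' S ∈ T := by
  constructor
  · rintro ⟨S', hS', rfl⟩
    simpa [← image_comp] using hS'
  · intro h
    refine ⟨_, h, ?_⟩
    simp [← image_comp]

/-! ### Outward normals, and the tree simplex along a flag -/

/-- A criterion for binary nonobtuse simplices in terms of explicit outward normals. -/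
theorem isBinarySimplex_of_normals {p u : Fin (n + 2) → EuclideanSpace ℝ (Fin (n + 1))}
    (hp : ∀ i, p i ∈ cubeVertices (n + 1))
    (h0 : ∀ i j k, j ≠ i → k ≠ i → inner ℝ (u i) (p j - p k) = 0)
    (h1 : ∀ i j, j ≠ i → inner ℝ (u i) (p i - p j) < 0)
    (h2 : ∀ i j, i ≠ j → inner ℝ (u i) (u j) ≤ 0) :
    IsBinarySimplex (range p) ∧ IsNonobtuse (range p) := by
  -- Pairing an affine relation with `u i` kills all terms but the `i`-th.
  have hind : AffineIndependent ℝ p := by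
    rw [affineIndependent_iff]
    intro s w hw hwp i hi
    obtain ⟨k, hk⟩ := exists_ne i
    have h : ∑ j ∈ s, w j • (p j - p k) = 0 := by
      simp only [smul_sub, Finset.sum_sub_distrib, hwp, ← Finset.sum_smul, hw, zero_smul, sub_zero]
    have := congrArg (fun x => inner ℝ (u i) x) h
    simp only [inner_sum, inner_smul_right, inner_zero_right] at this
    rw [Finset.sum_eq_single i (fun j _ hj => by rw [h0 i j k hj hk, mul_zero])
      (fun h => absurd hi h)] at this
    exact (mul_eq_zero.1 this).resolve_right (h1 i k hk).ne
  have hb : IsBinarySimplex (range p) := by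
    refine ⟨range_subset_iff.2 hp, ?_, hind.range⟩
    rw [← image_univ, ncard_image_of_injective _ hind.injective, ncard_univ, Nat.card_fin]
  refine ⟨hb, ?_⟩
  -- Outward normals at a vertex are unique up to a positive factor, so the angles may be computed
  -- from the given `u`.
  have hscale : ∀ i v, IsOutwardNormal (range p) (p i) v → ∃ c : ℝ, 0 < c ∧ v = c • u i := by
    intro i v hv
    obtain ⟨k, hk⟩ := exists_ne i
    have hpk : p k ∈ range p \ {p i} := ⟨mem_range_self k, fun h => hk (hind.injective h)⟩
    refine ⟨inner ℝ v (p i - p k) / inner ℝ (u i) (p i - p k),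
      div_pos_of_neg_of_neg (hv.2.2 _ hpk) (h1 i k hk), ?_⟩
    rw [← sub_eq_zero]
    refine hb.eq_zero_of_inner (p := p k) ?_
    rintro _ ⟨j, rfl⟩
    rw [inner_sub_left, inner_smul_left]
    by_cases hj : j = i
    · subst hj
      have := (h1 j k hk).ne
      simp only [conj_trivial]
      field_simp
      ring
    · rw [h0 i j k hj hk,
        hv.2.1 _ ⟨mem_range_self j, fun h => hj (hind.injective h)⟩ _ hpk]
      simp
  rintro _ ⟨i, rfl⟩ _ ⟨j, rfl⟩ hij θ ⟨v, w, hv, hw, rfl⟩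
  obtain ⟨c, hc, rfl⟩ := hscale i v hv
  obtain ⟨d, hd, rfl⟩ := hscale j w hw
  rw [InnerProductGeometry.angle_smul_left_of_pos _ _ hc,
    InnerProductGeometry.angle_smul_right_of_pos _ _ hd]
  have : Real.pi / 2 ≤ InnerProductGeometry.angle (u i) (u j) := by
    rw [InnerProductGeometry.angle, ← not_lt, Real.arccos_lt_pi_div_two, not_lt]
    exact div_nonpos_of_nonpos_of_nonneg (h2 i j (fun h => hij (h ▸ rfl)))
      (mul_nonneg (norm_nonneg _) (norm_nonneg _))
  linarith

/-- Some simplex has a face of each dimension in the members of the standard flag of cube faces. -/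
theorem IsBinaryTriangulation.exists_flag {T : Set (Set (EuclideanSpace ℝ (Fin n)))}
    (hT : IsBinaryTriangulation T) :
    ∃ S ∈ T, 0 ∈ S ∧ ∀ j : Fin n, ∃ p ∈ S, p j = 1 ∧ ∀ i, j < i → p i = 0 := by
  -- Induction along the flag: the next coordinate of `x` is chosen small relative to the point
  -- built so far, so every simplex containing the new point contains the old one and also has a
  -- vertex reaching into the new direction.
  have key : ∀ k ≤ n, ∃ x ∈ unitCube n, (∀ i : Fin n, k ≤ i → x i = 0) ∧
      ∀ S ∈ T, x ∈ convexHull ℝ S → 0 ∈ S ∧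
        ∀ j : Fin n, (j : ℕ) < k → ∃ p ∈ S, p j = 1 ∧ ∀ i, j < i → p i = 0 := by
    intro k
    induction k with
    | zero =>
      refine fun _ => ⟨0, fun i => by simp, by simp, fun S hS h => ⟨?_, by simp⟩⟩
      exact mem_of_mem_convexHull_of_cubeVertices (hT.isBinarySimplex S hS).subset_cubeVertices
        (fun i => by simp) h
    | succ k ih =>
      intro hk
      obtain ⟨x, hx, hx0, hxS⟩ := ih (by omega)
      obtain ⟨ε, hε, hball⟩ := hT.exists_ball x
      set δ := min (ε / 2) 1 with hδ
      have hδ0 : 0 < δ := lt_min (by linarith) one_pos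
      have hδε : δ < ε := (min_le_left _ _).trans_lt (by linarith)
      set K : Fin n := ⟨k, by omega⟩ with hK
      set y := x + EuclideanSpace.single K δ with hy
      have hyi : ∀ i, i ≠ K → y i = x i := fun i hi => by simp [hy, hi]
      have hyK : y K = δ := by simp [hy, hx0 K le_rfl]
      refine ⟨y, fun i => ?_, fun i hi => ?_, fun S hS hyS => ?_⟩
      · by_cases hi : i = K
        · rw [hi, hyK]; exact ⟨hδ0.le, min_le_right _ _⟩
        · rw [hyi i hi]; exact hx i
      · rw [hyi i (by rintro rfl; simp [hK] at hi), hx0 i (by omega)]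
      · have hd : dist y x < ε := by
          rw [hy, dist_eq_norm, add_sub_cancel_left, PiLp.norm_single, Real.norm_eq_abs,
            abs_of_pos hδ0]
          exact hδε
        obtain ⟨h0, hj⟩ := hxS S hS (hball y hd S hS hyS)
        refine ⟨h0, fun j hjk => ?_⟩
        rcases Nat.lt_succ_iff_lt_or_eq.1 hjk with h | h
        · exact hj j h
        obtain rfl : j = K := Fin.ext h
        by_contra hc
        push Not at hc
        have hSv := (hT.isBinarySimplex S hS).subset_cubeVertices
        -- At a cube vertex, `x K - ∑_{i > K} x i` is positive only if `K` is the last nonzero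
        -- coordinate. Without such a vertex in `S` it is nonpositive on the hull, yet it equals `δ`
        -- at `y`.
        set a : EuclideanSpace ℝ (Fin n) :=
          WithLp.toLp 2 fun i => if i < K then 0 else if i = K then 1 else -1 with ha
        have hin : ∀ p : EuclideanSpace ℝ (Fin n), inner ℝ a p =
            p K - ∑ i ∈ Finset.univ.filter (fun i => K < i), p i := by
          intro p
          have hK : p K = ∑ i, if i = K then p i else 0 := by simp
          rw [hK, Finset.sum_filter, ← Finset.sum_sub_distrib]
          simp only [ha, PiLp.inner_apply, RCLike.inner_apply, conj_trivial]
          refine Finset.sum_congr rfl fun i _ => ?_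
          rcases lt_trichotomy i K with h | h | h
          · simp [h, h.not_gt, h.ne]
          · simp [h]
          · simp [h, h.not_gt, h.ne']
        have := inner_le_of_mem_convexHull (u := a) (c := 0) (fun p hp => ?_) hyS
        · rw [hin, Finset.sum_eq_zero, hyK] at this
          · linarith
          · intro i hi
            rw [Finset.mem_filter] at hi
            rw [hyi i hi.2.ne', hx0 i (by have := hi.2; rw [Fin.lt_def] at this; exact this.le)]
        · rw [hin]
          have hnn : ∀ i, 0 ≤ p i := fun i =>
            (cubeVertices_subset_unitCube n (hSv hp) i).1
          rcases hSv hp K with h | h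
          · rw [h]
            have := Finset.sum_nonneg (s := Finset.univ.filter (fun i => K < i)) fun i _ => hnn i
            linarith
          · obtain ⟨i, hi, hpi⟩ := hc p hp h
            have := Finset.single_le_sum (s := Finset.univ.filter (fun i => K < i))
              (f := fun i => p i) (fun i _ => hnn i) (Finset.mem_filter.2 ⟨Finset.mem_univ i, hi⟩)
            have hp1 := (hSv hp i).resolve_left hpi
            simp only [hp1] at this
            linarith
  obtain ⟨x, hx, -, hxS⟩ := key n le_rfl
  obtain ⟨S, hS, hxm⟩ := hT.exists_mem hx
  exact ⟨S, hS, (hxS S hS hxm).1, fun j => (hxS S hS hxm).2 j j.2⟩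

/-- Every nonobtuse binary triangulation contains a simplex that is built up from the origin by
successively adding, for each coordinate direction, the translate of a previous vertex. -/
theorem IsNonobtuseBinaryTriangulation.exists_tree {T : Set (Set (EuclideanSpace ℝ (Fin n)))}
    (hT : IsNonobtuseBinaryTriangulation T) (hn : 0 < n) :
    ∃ p : Fin n → EuclideanSpace ℝ (Fin n), insert 0 (range p) ∈ T ∧
      ∀ j, p j - EuclideanSpace.single j 1 ∈ insert 0 (p '' {i | i < j}) := by
  obtain ⟨S, hS, h0, hp⟩ := hT.1.exists_flag
  choose p hpS hp1 hp0 using hp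
  have hSb := hT.1.isBinarySimplex S hS
  have hpinj : Function.Injective p := by
    intro i j hij
    rcases lt_trichotomy i j with h | h | h
    · have := hp0 i j h
      rw [hij, hp1] at this
      exact absurd this one_ne_zero
    · exact h
    · have := hp0 j i h
      rw [← hij, hp1] at this
      exact absurd this one_ne_zero
  have hpne : ∀ i, p i ≠ 0 := fun i h => by
    have := hp1 i
    rw [h] at this
    simp at this
  set F : ℕ → Set (EuclideanSpace ℝ (Fin n)) := fun k => insert 0 (p '' {i | (i : ℕ) < k}) with hF
  have hFn : F n = S := by
    refine eq_of_subset_of_ncard_le ?_ ?_ hSb.finite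
    · rintro x (rfl | ⟨i, -, rfl⟩)
      exacts [h0, hpS i]
    · have e : {i : Fin n | (i : ℕ) < n} = univ := by ext i; simp
      rw [hF, hSb.ncard_eq]
      simp only [e]
      rw [ncard_insert_of_notMem (by rintro ⟨i, -, h⟩; exact hpne i h) (toFinite _),
        ncard_image_of_injective _ hpinj, ncard_univ, Nat.card_fin]
  have hFsucc : ∀ k : Fin n, F (k + 1) \ {p k} = F k := by
    intro k
    ext x
    simp only [hF, mem_sdiff, mem_insert_iff, mem_image, mem_ofPred_eq, mem_singleton_iff]
    constructor
    · rintro ⟨rfl | ⟨i, hi, rfl⟩, hx⟩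
      · exact Or.inl rfl
      · exact Or.inr ⟨i, lt_of_le_of_ne (Nat.lt_succ_iff.1 hi)
          fun h => hx (congrArg p (Fin.ext h)), rfl⟩
    · rintro (rfl | ⟨i, hi, rfl⟩)
      · exact ⟨Or.inl rfl, fun h => hpne k h.symm⟩
      · exact ⟨Or.inr ⟨i, by omega, rfl⟩, fun h => by
          rw [hpinj h] at hi; exact lt_irrefl _ hi⟩
  have hpF : ∀ k : Fin n, p k ∈ F (k + 1) := fun k => mem_insert_of_mem _ ⟨k, Nat.lt_succ_self _, rfl⟩
  -- The property descends from the whole simplex by dropping the last vertex each time; `m = n - k`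
  -- turns this into an upward induction.
  have hproj : ∀ m k : ℕ, k + m = n → 1 ≤ k → ProjectsInside (F k) := by
    intro m
    induction m with
    | zero =>
      intro k hk _
      obtain rfl : k = n := hk
      rw [hFn]
      exact (hT.2 S hS).projectsInside hSb hn
    | succ m ih =>
      intro k hk h1
      have e := hFsucc ⟨k, by omega⟩
      simp only at e
      rw [← e]
      refine (ih (k + 1) (by omega) (by omega)).diff_singleton (hpF ⟨k, by omega⟩) ?_
      rw [e]
      exact ⟨0, mem_insert _ _, p ⟨0, hn⟩, mem_insert_of_mem _ ⟨⟨0, hn⟩, h1, rfl⟩, (hpne _).symm⟩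
  have hFv : ∀ k, F k ⊆ cubeVertices n := by
    rintro k x (rfl | ⟨i, -, rfl⟩)
    · exact fun i => by simp
    · exact hSb.subset_cubeVertices (hpS i)
  refine ⟨p, ?_, fun j => ?_⟩
  · have e : {i : Fin n | (i : ℕ) < n} = univ := by ext i; simp
    have : F n = insert 0 (range p) := by simp only [hF, e, image_univ]
    rw [← this, hFn]
    exact hS
  obtain ⟨z, hz, ho⟩ := hproj (n - (j + 1)) (j + 1) (by omega) (by omega) (p j) (hpF j)
  rw [hFsucc] at hz ho
  have hzj : ∀ i, j ≤ i → z i = 0 := by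
    intro i hi
    have := inner_eq_of_mem_convexHull (u := EuclideanSpace.single i (1 : ℝ)) (c := 0) (S := F j)
      (fun x hx => ?_) hz
    · simpa [EuclideanSpace.inner_single_left] using this
    rcases hx with rfl | ⟨l, hl, rfl⟩
    · simp
    · simpa [EuclideanSpace.inner_single_left] using hp0 l i (lt_of_lt_of_le (Fin.lt_def.2 hl) hi)
  -- Orthogonality of `p j - z` to each `p i` with `i < j` is a triangular system with ones on the
  -- diagonal, so the coordinates before the `j`-th vanish. The later ones of `z` are zero by `hzj`,
  -- which leaves `z = p j - e_j`.
  have hdj : ∀ m : ℕ, ∀ i : Fin n, (i : ℕ) = m → i < j → (p j - z) i = 0 := by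
    intro m
    induction m using Nat.strong_induction_on with
    | _ m ih =>
      rintro i rfl hij
      have := ho (p i) (mem_insert_of_mem _ ⟨i, hij, rfl⟩) 0 (mem_insert _ _)
      rw [sub_zero, PiLp.inner_apply, Finset.sum_eq_single i] at this
      · simpa [hp1] using this
      · intro l _ hl
        rcases lt_or_gt_of_ne hl with h | h
        · rw [ih l h l rfl (h.trans hij)]; simp
        · rw [hp0 i l h]; simp
      · simp
  have hze : z = p j - EuclideanSpace.single j 1 := by
    ext i
    rcases lt_trichotomy i j with h | h | h
    · have := hdj i i rfl h
      simp only [PiLp.sub_apply, PiLp.single_apply, h.ne, if_false] at this ⊢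
      linarith
    · subst h
      rw [hzj i le_rfl]
      simp [hp1]
    · rw [hzj i h.le]
      simp [hp0 j i h, h.ne']
  have hzv : z ∈ cubeVertices n := by
    intro i
    by_cases h : i = j
    · exact Or.inl (hzj i h.ge)
    · rw [hze]
      simpa [h] using hSb.subset_cubeVertices (hpS j) i
  have := mem_of_mem_convexHull_of_cubeVertices (hFv j) hzv hz
  rw [hze] at this
  exact this

/-! ### Binary encoding of vertices and symmetries -/

/-- The vertex of the cube whose coordinates are the binary digits of `m`. -/
def vertex (n m : ℕ) : EuclideanSpace ℝ (Fin n) :=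
  WithLp.toLp 2 fun i => if m.testBit i then 1 else 0

/-- The set of the vertices of the cube that are encoded by the members of a list. -/
def vertices (n : ℕ) (L : List ℕ) : Set (EuclideanSpace ℝ (Fin n)) :=
  {x | ∃ m ∈ L, vertex n m = x}

theorem vertex_apply (m : ℕ) (i : Fin n) : vertex n m i = if m.testBit i then 1 else 0 := rfl

theorem vertex_mem_cubeVertices (n m : ℕ) : vertex n m ∈ cubeVertices n := by
  intro i
  rw [vertex_apply]
  split_ifs <;> simp

theorem vertex_zero (n : ℕ) : vertex n 0 = 0 := by
  ext i; simp [vertex_apply]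

theorem exists_vertex_eq {x : EuclideanSpace ℝ (Fin n)} (hx : x ∈ cubeVertices n) :
    ∃ m < 2 ^ n, vertex n m = x := by
  refine ⟨Nat.ofBits fun i => decide (x i = 1), Nat.ofBits_lt_two_pow _, ?_⟩
  ext i
  rw [vertex_apply, Nat.testBit_ofBits_lt _ _ i.2]
  rcases hx i with h | h <;> simp [h]

theorem vertex_injOn {m m' : ℕ} (hm : m < 2 ^ n) (hm' : m' < 2 ^ n)
    (h : vertex n m = vertex n m') : m = m' := by
  refine Nat.eq_of_testBit_eq fun i => ?_
  by_cases hi : i < n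
  · have := congrArg (fun x => x ⟨i, hi⟩) h
    simp only [vertex_apply] at this
    by_cases h1 : m.testBit i <;> by_cases h2 : m'.testBit i <;> simp_all
  · rw [Nat.testBit_eq_false_of_lt (hm.trans_le (Nat.pow_le_pow_right two_pos (not_lt.1 hi))),
      Nat.testBit_eq_false_of_lt (hm'.trans_le (Nat.pow_le_pow_right two_pos (not_lt.1 hi)))]

theorem vertices_congr {L L' : List ℕ} (h : ∀ m, m ∈ L ↔ m ∈ L') : vertices n L = vertices n L' := by
  ext x
  simp only [vertices, mem_ofPred_eq, h]

theorem vertices_cons (m : ℕ) (L : List ℕ) :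
    vertices n (m :: L) = insert (vertex n m) (vertices n L) := by
  ext x
  simp [vertices, eq_comm]

theorem vertices_map {k : ℕ} (g : EuclideanSpace ℝ (Fin k) → EuclideanSpace ℝ (Fin n)) (f : ℕ → ℕ)
    (h : ∀ m, g (vertex k m) = vertex n (f m)) (L : List ℕ) :
    vertices n (L.map f) = g '' vertices k L := by
  ext x
  simp only [vertices, List.mem_map, mem_image, mem_ofPred_eq]
  constructor
  · rintro ⟨_, ⟨m, hm, rfl⟩, rfl⟩
    exact ⟨_, ⟨m, hm, rfl⟩, h m⟩
  · rintro ⟨_, ⟨m, hm, rfl⟩, rfl⟩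
    exact ⟨_, ⟨m, hm, rfl⟩, (h m).symm⟩

/-- The isometry that permutes the coordinates. -/
def permIsometry (σ : Equiv.Perm (Fin n)) :
    EuclideanSpace ℝ (Fin n) ≃ᵃⁱ[ℝ] EuclideanSpace ℝ (Fin n) :=
  (LinearIsometryEquiv.piLpCongrLeft 2 ℝ ℝ σ).toAffineIsometryEquiv

theorem permIsometry_apply (σ : Equiv.Perm (Fin n)) (x : EuclideanSpace ℝ (Fin n)) (i : Fin n) :
    permIsometry σ x i = x (σ.symm i) := rfl

theorem permIsometry_symm (σ : Equiv.Perm (Fin n)) :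
    (permIsometry σ).symm = permIsometry σ.symm := by
  ext x : 1
  apply (permIsometry σ).injective
  rw [AffineIsometryEquiv.apply_symm_apply]
  ext i
  simp [permIsometry_apply]

theorem isCubeSymmetry_permIsometry (σ : Equiv.Perm (Fin n)) : IsCubeSymmetry (permIsometry σ) := by
  have h : ∀ σ : Equiv.Perm (Fin n), MapsTo (permIsometry σ) (unitCube n) (unitCube n) :=
    fun σ x hx i => hx _
  exact isCubeSymmetry_of_mapsTo (h σ) (permIsometry_symm σ ▸ h σ.symm)

/-- The action of a permutation of the coordinates on encoded vertices. -/
def permuteBits (n : ℕ) (f : Fin n → Fin n) (m : ℕ) : ℕ :=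
  Nat.ofBits fun i => m.testBit (f i)

theorem permIsometry_vertex (σ : Equiv.Perm (Fin n)) (m : ℕ) :
    permIsometry σ (vertex n m) = vertex n (permuteBits n σ.symm m) := by
  ext i
  rw [permIsometry_apply, vertex_apply, vertex_apply, permuteBits, Nat.testBit_ofBits_lt _ _ i.2]

/-- The reflection of the cube in the coordinate directions given by the binary digits of `a`. -/
def reflection (n a : ℕ) : EuclideanSpace ℝ (Fin n) ≃ᵃⁱ[ℝ] EuclideanSpace ℝ (Fin n) :=
  (LinearIsometryEquiv.piLpCongrRight 2 fun i : Fin n =>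
    if a.testBit i then LinearIsometryEquiv.neg ℝ (E := ℝ) else
      LinearIsometryEquiv.refl ℝ ℝ).toAffineIsometryEquiv.trans
    (AffineIsometryEquiv.constVAdd ℝ _ (vertex n a))

theorem reflection_apply (a : ℕ) (x : EuclideanSpace ℝ (Fin n)) (i : Fin n) :
    reflection n a x i = if a.testBit i then 1 - x i else x i := by
  have : reflection n a x i = vertex n a i + (if a.testBit i then LinearIsometryEquiv.neg ℝ (E := ℝ)
      else LinearIsometryEquiv.refl ℝ ℝ) (x i) := rfl
  rw [this, vertex_apply]
  split_ifs <;> simp [sub_eq_add_neg]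

theorem isCubeSymmetry_reflection (n a : ℕ) : IsCubeSymmetry (reflection n a) := by
  have h : MapsTo (reflection n a) (unitCube n) (unitCube n) := by
    intro x hx i
    rw [reflection_apply]
    have := hx i
    rw [mem_Icc] at this
    split_ifs
    · constructor <;> linarith
    · exact this
  refine isCubeSymmetry_of_mapsTo h fun x hx => ?_
  have : (reflection n a).symm x = reflection n a x := by
    rw [← (reflection n a).injective.eq_iff, AffineIsometryEquiv.apply_symm_apply]
    ext i
    simp only [reflection_apply]
    split_ifs <;> ring
  rw [this]
  exact h hx

theorem reflection_vertex (a m : ℕ) :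
    reflection n a (vertex n m) = vertex n (m ^^^ a) := by
  ext i
  rw [reflection_apply, vertex_apply, vertex_apply, Nat.testBit_xor]
  cases a.testBit i <;> cases m.testBit i <;> simp

/-- Up to a symmetry of the cube, `T` is the standard or the cone triangulation. -/
def IsStandardOrCone (T : Set (Set (EuclideanSpace ℝ (Fin n)))) : Prop :=
  ∃ g : EuclideanSpace ℝ (Fin n) ≃ᵃⁱ[ℝ] EuclideanSpace ℝ (Fin n), IsCubeSymmetry g ∧
    (T = mapSimplices g (standardTriangulation n) ∨ T = mapSimplices g (coneTriangulation n))

theorem IsStandardOrCone.of_mapSimplices {T : Set (Set (EuclideanSpace ℝ (Fin n)))}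
    {g : EuclideanSpace ℝ (Fin n) ≃ᵃⁱ[ℝ] EuclideanSpace ℝ (Fin n)} (hg : IsCubeSymmetry g)
    (h : IsStandardOrCone (mapSimplices g T)) : IsStandardOrCone T := by
  obtain ⟨g', hg', h⟩ := h
  refine ⟨g'.trans g.symm, hg'.trans hg.symm, ?_⟩
  rw [mapSimplices_trans, mapSimplices_trans]
  rcases h with h | h
  · left; rw [← h, mapSimplices_symm_mapSimplices]
  · right; rw [← h, mapSimplices_symm_mapSimplices]

/-- Every nonobtuse binary triangulation containing the encoded simplex is, up to a symmetry, one of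
the two triangulations of the classification. -/
def Forces (n : ℕ) (L : List ℕ) : Prop :=
  ∀ T, IsNonobtuseBinaryTriangulation T → vertices n L ∈ T → IsStandardOrCone T

theorem Forces.congr {L L' : List ℕ} (h : Forces n L) (hL : ∀ m, m ∈ L ↔ m ∈ L') : Forces n L' := by
  intro T hT hm
  rw [← vertices_congr hL] at hm
  exact h T hT hm

theorem Forces.of_symmetry {g : EuclideanSpace ℝ (Fin n) ≃ᵃⁱ[ℝ] EuclideanSpace ℝ (Fin n)}
    (hg : IsCubeSymmetry g) {f : ℕ → ℕ} (hf : ∀ m, g (vertex n m) = vertex n (f m)) {L : List ℕ}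
    (h : Forces n (L.map f)) : Forces n L := by
  intro T hT hL
  refine .of_mapSimplices hg (h _ (hT.mapSimplices hg) ?_)
  rw [vertices_map g f hf]
  exact mem_image_of_mem _ hL

theorem Forces.of_xor (a : ℕ) {L : List ℕ} (h : Forces n (L.map (· ^^^ a))) : Forces n L :=
  h.of_symmetry (isCubeSymmetry_reflection n a) (reflection_vertex a)

theorem Forces.permuteBits {f : Fin n → Fin n} (hf : Function.Injective f) {L : List ℕ}
    (h : Forces n L) : Forces n (L.map (permuteBits n f)) := by
  intro T hT hL
  have hb : Function.Bijective f := Finite.injective_iff_bijective.1 hf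
  -- Coordinate isometries act on codes through the inverse permutation, hence the `symm`.
  set g := permIsometry (Equiv.ofBijective f hb).symm
  have hg : IsCubeSymmetry g := isCubeSymmetry_permIsometry _
  refine .of_mapSimplices hg.symm (h _ (hT.mapSimplices hg.symm) ?_)
  rw [mem_mapSimplices_symm, ← vertices_map g _ (permIsometry_vertex _)]
  exact hL

/-! ### Integer certificates -/

/-- A vector with integer coordinates. -/
def intVector (a : Fin n → ℤ) : EuclideanSpace ℝ (Fin n) :=
  WithLp.toLp 2 fun i => (a i : ℝ)

/-- The inner product of an integer vector with an encoded vertex. -/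
def vertexDot (a : Fin n → ℤ) (m : ℕ) : ℤ :=
  ∑ i : Fin n, if m.testBit i then a i else 0

theorem inner_intVector_vertex (a : Fin n → ℤ) (m : ℕ) :
    inner ℝ (intVector a) (vertex n m) = vertexDot a m := by
  simp [intVector, vertex, vertexDot, PiLp.inner_apply]

theorem inner_intVector_intVector (a b : Fin n → ℤ) :
    inner ℝ (intVector a) (intVector b) = ((∑ i, a i * b i : ℤ) : ℝ) := by
  simp [intVector, PiLp.inner_apply, mul_comm]

/-- A certificate that `ν` is a normal vector of the facet `F` in the interior of the cube, with `p`
on its negative side, and that each vertex on the positive side is among the vertices `qs`, or is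
excluded by a pair `(a, d)` in `certs`: the inequality `d ≤ ⟪a, x⟫` is valid on `F` but not for the
orthogonal projection of the vertex. -/
def IsNeighborCertificate (p : ℕ) (F qs : List ℕ) (ν : Fin n → ℤ) (c : ℤ)
    (certs : List ((Fin n → ℤ) × ℤ)) : Prop :=
  (∀ x ∈ F, vertexDot ν x = c) ∧ vertexDot ν p < c ∧
    (∀ i : Fin n, (∃ x ∈ F, x.testBit i = false) ∧ ∃ x ∈ F, x.testBit i = true) ∧
    (∀ a ∈ certs, (∀ x ∈ F, a.2 ≤ vertexDot a.1 x) ∧ 0 ≤ ∑ i, a.1 i * ν i) ∧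
    ∀ q < 2 ^ n, q ∈ qs ∨ vertexDot ν q ≤ c ∨ ∃ a ∈ certs, vertexDot a.1 q < a.2 ∨
      (vertexDot a.1 q ≤ a.2 ∧ 0 < ∑ i, a.1 i * ν i)

instance (p : ℕ) (F qs : List ℕ) (ν : Fin n → ℤ) (c : ℤ) (certs : List ((Fin n → ℤ) × ℤ)) :
    Decidable (IsNeighborCertificate p F qs ν c certs) := by
  unfold IsNeighborCertificate
  infer_instance

/-- The foot `q - t ν`, with `t > 0`, lies in the hull of `F`, so `⟪a, q⟫ - t ⟪a, ν⟫ ≥ d`. As `⟪a,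
ν⟫ ≥ 0`, this fails if `⟪a, q⟫ < d`, and also at equality if `⟪a, ν⟫ > 0`. -/
theorem IsNeighborCertificate.exists_neighbor {p : ℕ} {F qs : List ℕ} {ν : Fin n → ℤ} {c : ℤ}
    {certs : List ((Fin n → ℤ) × ℤ)} (h : IsNeighborCertificate p F qs ν c certs) (hn : 0 < n)
    {T : Set (Set (EuclideanSpace ℝ (Fin n)))} (hT : IsNonobtuseBinaryTriangulation T)
    (hS : vertices n (p :: F) ∈ T) : ∃ q ∈ qs, vertices n (q :: F) ∈ T := by
  obtain ⟨hF, hp, hint, hcerts, hq⟩ := h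
  simp only [vertices_cons] at hS ⊢
  obtain ⟨x, hx, hcx, hxT, t, ht, hz⟩ := hT.exists_neighbor (ν := intVector ν) (c := c) hS hn
    (by rintro _ ⟨m, hm, rfl⟩; rw [inner_intVector_vertex, hF m hm])
    (by rw [inner_intVector_vertex]; exact_mod_cast hp)
    (fun i => by
      obtain ⟨m, hm, hmi⟩ := (hint i).1
      exact ⟨_, ⟨m, hm, rfl⟩, by simp [vertex_apply, hmi]⟩)
    (fun i => by
      obtain ⟨m, hm, hmi⟩ := (hint i).2
      exact ⟨_, ⟨m, hm, rfl⟩, by simp [vertex_apply, hmi]⟩)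
  obtain ⟨q, hq2, rfl⟩ := exists_vertex_eq hx
  rcases hq q hq2 with h | h | ⟨a, ha, h⟩
  · exact ⟨q, h, hxT⟩
  · rw [inner_intVector_vertex] at hcx
    exact absurd (by exact_mod_cast hcx) (not_lt.2 h)
  · exfalso
    obtain ⟨h1, h2⟩ := hcerts a ha
    have h3 : (a.2 : ℝ) ≤ inner ℝ (intVector a.1) (vertex n q - t • intVector ν) := by
      refine le_inner_of_mem_convexHull ?_ hz
      rintro _ ⟨m, hm, rfl⟩
      rw [inner_intVector_vertex]
      exact_mod_cast h1 m hm
    rw [inner_sub_right, inner_smul_right, inner_intVector_vertex, inner_intVector_intVector] at h3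
    have h2' : (0 : ℝ) ≤ ((∑ i, a.1 i * ν i : ℤ) : ℝ) := by exact_mod_cast h2
    rcases h with h | ⟨h, h'⟩
    · have h4 : (vertexDot a.1 q : ℝ) < a.2 := by exact_mod_cast h
      nlinarith
    · have h4 : (vertexDot a.1 q : ℝ) ≤ a.2 := by exact_mod_cast h
      have h5 : (0 : ℝ) < ((∑ i, a.1 i * ν i : ℤ) : ℝ) := by exact_mod_cast h'
      nlinarith

theorem vertices_ofFn {k : ℕ} (p : Fin k → ℕ) :
    vertices n (List.ofFn p) = range fun i => vertex n (p i) := by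
  ext x
  simp [vertices, List.mem_ofFn]

/-- A criterion for encoded nonobtuse simplices in terms of integer outward normals. -/
theorem isBinarySimplex_ofFn {p : Fin (n + 2) → ℕ} (u : Fin (n + 2) → Fin (n + 1) → ℤ)
    (c : Fin (n + 2) → ℤ)
    (h : ∀ i, vertexDot (u i) (p i) < c i ∧
      ∀ j, j ≠ i → vertexDot (u i) (p j) = c i ∧ ∑ k, u i k * u j k ≤ 0) :
    IsBinarySimplex (vertices (n + 1) (List.ofFn p)) ∧
      IsNonobtuse (vertices (n + 1) (List.ofFn p)) := by
  rw [vertices_ofFn]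
  refine isBinarySimplex_of_normals (u := fun i => intVector (u i))
    (fun i => vertex_mem_cubeVertices _ _) ?_ ?_ ?_
  · intro i j k hj hk
    rw [inner_sub_right, inner_intVector_vertex, inner_intVector_vertex, ((h i).2 j hj).1,
      ((h i).2 k hk).1, sub_self]
  · intro i j hj
    rw [inner_sub_right, inner_intVector_vertex, inner_intVector_vertex, ((h i).2 j hj).1, sub_neg]
    exact_mod_cast (h i).1
  · intro i j hij
    rw [inner_intVector_intVector]
    exact_mod_cast ((h i).2 j hij.symm).2

theorem mem_convexHull_vertices {k : ℕ} {p : Fin k → ℕ} {x : EuclideanSpace ℝ (Fin n)}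
    (w : Fin k → ℝ) (h0 : ∀ i, 0 ≤ w i) (h1 : ∑ i, w i = 1)
    (hx : ∀ j : Fin n, ∑ i, (if (p i).testBit j then w i else 0) = x j) :
    x ∈ convexHull ℝ (vertices n (List.ofFn p)) := by
  have : x = ∑ i, w i • vertex n (p i) := by
    ext j
    simp [← hx j, vertex_apply]
  rw [this, vertices_ofFn]
  exact (convex_convexHull ℝ _).sum_mem (fun i _ => h0 i) h1
    fun i _ => subset_convexHull ℝ _ (mem_range_self i)

/-! ### Triangulations that are orbits under coordinate permutations -/

/-- The simplices that arise from the encoded ones by permutations of the coordinates. -/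
def permOrbit (n : ℕ) (R : List (List ℕ)) : Set (Set (EuclideanSpace ℝ (Fin n))) :=
  {S | ∃ σ : Equiv.Perm (Fin n), ∃ L ∈ R, permIsometry σ '' vertices n L = S}

theorem exists_antitone (x : EuclideanSpace ℝ (Fin n)) : ∃ σ : Equiv.Perm (Fin n),
    ∃ y : EuclideanSpace ℝ (Fin n), Antitone (fun i => y i) ∧ permIsometry σ y = x := by
  refine ⟨Tuple.sort fun i => -x i, (permIsometry (Tuple.sort fun i => -x i)).symm x, ?_,
    AffineIsometryEquiv.apply_symm_apply _ _⟩
  intro i j hij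
  have := Tuple.monotone_sort (fun i => -x i) hij
  simpa [permIsometry_symm, permIsometry_apply] using this

/-- A criterion for the orbit of some simplices under the permutations of the coordinates to be a
nonobtuse binary triangulation. The face to face property follows from a height function `H` of the
coordinate sums of the vertices that lifts the simplices to lower faces. -/
theorem isNonobtuseBinaryTriangulation_permOrbit {R : List (List ℕ)}
    (hR : ∀ L ∈ R, IsBinarySimplex (vertices n L) ∧ IsNonobtuse (vertices n L)) (H : ℤ → ℤ)
    (hH : ∀ L ∈ R, (∀ m ∈ L, m < 2 ^ n) ∧ ∃ (a : Fin n → ℤ) (d : ℤ), ∀ m < 2 ^ n,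
      vertexDot a m + d ≤ H (vertexDot (fun _ : Fin n => 1) m) ∧
        (vertexDot a m + d = H (vertexDot (fun _ : Fin n => 1) m) ↔ m ∈ L))
    (hcover : ∀ x ∈ unitCube n, Antitone (fun i => x i) →
      ∃ L ∈ R, x ∈ convexHull ℝ (vertices n L)) :
    IsNonobtuseBinaryTriangulation (permOrbit n R) := by
  have hs : ∀ S ∈ permOrbit n R, IsBinarySimplex S ∧ IsNonobtuse S := by
    rintro _ ⟨σ, L, hL, rfl⟩
    exact ⟨(hR L hL).1.image (isCubeSymmetry_permIsometry σ), (hR L hL).2.image _⟩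
  refine ⟨⟨fun S hS => (hs S hS).1, ?_, ?_⟩, fun S hS => (hs S hS).2⟩
  · refine Subset.antisymm (iUnion₂_subset fun S hS => convexHull_min
      ((hs S hS).1.subset_cubeVertices.trans (cubeVertices_subset_unitCube n))
      (convex_unitCube n)) fun x hx => ?_
    obtain ⟨σ, y, hy, rfl⟩ := exists_antitone x
    obtain ⟨L, hL, hyL⟩ := hcover y ((isCubeSymmetry_permIsometry σ).mem_unitCube_iff.1 hx) hy
    refine mem_biUnion (x := permIsometry σ '' vertices n L) ⟨σ, L, hL, rfl⟩ ?_
    rw [← image_convexHull]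
    exact mem_image_of_mem _ hyL
  -- The floor merely extends `H` to real sums; only the integral sums at vertices matter. Since `ω`
  -- is permutation invariant, one affine function per representative suffices.
  · set ω : EuclideanSpace ℝ (Fin n) → ℝ := fun x => H ⌊∑ i, x i⌋ with hω
    have hωv : ∀ m, ω (vertex n m) = H (vertexDot (fun _ : Fin n => 1) m) := by
      intro m
      have : ∑ i, vertex n m i = ((vertexDot (fun _ : Fin n => 1) m : ℤ) : ℝ) := by
        simp [vertexDot, vertex_apply]
      rw [hω]
      simp only [this, Int.floor_intCast]
    have hωσ : ∀ σ x, ω (permIsometry σ x) = ω x := by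
      intro σ x
      have : ∑ i, permIsometry σ x i = ∑ i, x i := by
        simp only [permIsometry_apply]
        exact Equiv.sum_comp σ.symm fun i => x i
      simp only [hω, this]
    have key : ∀ S ∈ permOrbit n R, ∃ f : EuclideanSpace ℝ (Fin n) →ᵃ[ℝ] ℝ,
        ∀ x ∈ cubeVertices n, f x ≤ ω x ∧ (f x = ω x ↔ x ∈ S) := by
      rintro _ ⟨σ, L, hL, rfl⟩
      obtain ⟨hlt, a, d, had⟩ := hH L hL
      refine ⟨((innerₛₗ ℝ (intVector a)).toAffineMap + AffineMap.const ℝ _ (d : ℝ)).comp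
        (permIsometry σ).symm.toAffineEquiv.toAffineMap, fun x hx => ?_⟩
      obtain ⟨m, hm, hmx⟩ := exists_vertex_eq
        ((isCubeSymmetry_permIsometry σ).symm.mapsTo_cubeVertices hx)
      obtain rfl : permIsometry σ (vertex n m) = x := by
        rw [hmx, AffineIsometryEquiv.apply_symm_apply]
      rw [hωσ, hωv, (permIsometry σ).injective.mem_set_image]
      have hf : (((innerₛₗ ℝ (intVector a)).toAffineMap + AffineMap.const ℝ _ (d : ℝ)).comp
        (permIsometry σ).symm.toAffineEquiv.toAffineMap) (permIsometry σ (vertex n m)) =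
          ((vertexDot a m + d : ℤ) : ℝ) := by
        simp [inner_intVector_vertex]
      rw [hf]
      refine ⟨by exact_mod_cast (had m hm).1, ?_⟩
      rw [Int.cast_inj, (had m hm).2]
      refine ⟨fun h => ⟨m, h, rfl⟩, ?_⟩
      rintro ⟨m', hm', h⟩
      rwa [← vertex_injOn (hlt m' hm') hm h]
    intro S hS S' hS'
    obtain ⟨f, hf⟩ := key S hS
    obtain ⟨f', hf'⟩ := key S' hS'
    exact convexHull_inter_of_height ω (hs S hS).1.subset_cubeVertices
      (hs S' hS').1.subset_cubeVertices f f' (fun x hx => (hf x hx).1) (fun x hx => (hf x hx).2)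
      (fun x hx => (hf' x hx).1) (fun x hx => (hf' x hx).2)

/-! ### The two explicit triangulations in dimension five -/

theorem path_spec : IsBinarySimplex (vertices 5 [0, 1, 3, 7, 15, 31]) ∧
    IsNonobtuse (vertices 5 [0, 1, 3, 7, 15, 31]) :=
  isBinarySimplex_ofFn (p := ![0, 1, 3, 7, 15, 31])
    -- The rows are outward normals of the facets opposite the listed vertices; the vector below
    -- holds their values on these facets.
    ![![1, 0, 0, 0, 0], ![-1, 1, 0, 0, 0], ![0, -1, 1, 0, 0], ![0, 0, -1, 1, 0],
      ![0, 0, 0, -1, 1], ![0, 0, 0, 0, -1]]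
    ![1, 0, 0, 0, 0, 0] (by decide +kernel)

theorem corner_spec : IsBinarySimplex (vertices 5 [0, 1, 2, 4, 8, 16]) ∧
    IsNonobtuse (vertices 5 [0, 1, 2, 4, 8, 16]) :=
  isBinarySimplex_ofFn (p := ![0, 1, 2, 4, 8, 16])
    ![![1, 1, 1, 1, 1], ![-1, 0, 0, 0, 0], ![0, -1, 0, 0, 0], ![0, 0, -1, 0, 0],
      ![0, 0, 0, -1, 0], ![0, 0, 0, 0, -1]]
    ![1, 0, 0, 0, 0, 0] (by decide +kernel)

theorem antipodal_spec : IsBinarySimplex (vertices 5 [31, 1, 2, 4, 8, 16]) ∧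
    IsNonobtuse (vertices 5 [31, 1, 2, 4, 8, 16]) :=
  isBinarySimplex_ofFn (p := ![31, 1, 2, 4, 8, 16])
    ![![-1, -1, -1, -1, -1], ![-3, 1, 1, 1, 1], ![1, -3, 1, 1, 1], ![1, 1, -3, 1, 1],
      ![1, 1, 1, -3, 1], ![1, 1, 1, 1, -3]]
    ![-1, 1, 1, 1, 1, 1] (by decide +kernel)

theorem cone4_spec : IsBinarySimplex (vertices 5 [31, 15, 1, 2, 4, 8]) ∧
    IsNonobtuse (vertices 5 [31, 15, 1, 2, 4, 8]) :=
  isBinarySimplex_ofFn (p := ![31, 15, 1, 2, 4, 8])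
    ![![0, 0, 0, 0, -1], ![-1, -1, -1, -1, 3], ![-2, 1, 1, 1, 0], ![1, -2, 1, 1, 0],
      ![1, 1, -2, 1, 0], ![1, 1, 1, -2, 0]]
    ![0, -1, 1, 1, 1, 1] (by decide +kernel)

theorem cone3_spec : IsBinarySimplex (vertices 5 [31, 15, 7, 1, 2, 4]) ∧
    IsNonobtuse (vertices 5 [31, 15, 7, 1, 2, 4]) :=
  isBinarySimplex_ofFn (p := ![31, 15, 7, 1, 2, 4])
    ![![0, 0, 0, 0, -1], ![0, 0, 0, -1, 1], ![-1, -1, -1, 2, 0], ![-1, 1, 1, 0, 0],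
      ![1, -1, 1, 0, 0], ![1, 1, -1, 0, 0]]
    ![0, 0, -1, 1, 1, 1] (by decide +kernel)

theorem cone2_spec : IsBinarySimplex (vertices 5 [31, 15, 7, 3, 1, 2]) ∧
    IsNonobtuse (vertices 5 [31, 15, 7, 3, 1, 2]) :=
  isBinarySimplex_ofFn (p := ![31, 15, 7, 3, 1, 2])
    ![![0, 0, 0, 0, -1], ![0, 0, 0, -1, 1], ![0, 0, -1, 1, 0], ![-1, -1, 1, 0, 0],
      ![0, 1, 0, 0, 0], ![1, 0, 0, 0, 0]]
    ![0, 0, 0, -1, 1, 1] (by decide +kernel)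

/-- The path simplex of the identity permutation. -/
def pathList : List ℕ := [0, 1, 3, 7, 15, 31]

/-- Representatives of the simplices of the cone triangulation of the five-dimensional cube. -/
def coneRepresentatives : List (List ℕ) :=
  [[0, 1, 2, 4, 8, 16], [31, 1, 2, 4, 8, 16], [31, 15, 1, 2, 4, 8], [31, 15, 7, 1, 2, 4],
    [31, 15, 7, 3, 1, 2]]

/-- A sum of `k` distinct odd positive numbers is at least `k ^ 2`, with equality only for the first
`k` of them. -/
theorem path_height : (∀ m ∈ pathList, m < 2 ^ 5) ∧ ∀ m < 2 ^ 5,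
    vertexDot ![-1, -3, -5, -7, -9] m + 0 ≤ (fun t : ℤ => -t ^ 2) (vertexDot (fun _ : Fin 5 => 1) m) ∧
      (vertexDot ![-1, -3, -5, -7, -9] m + 0 = (fun t : ℤ => -t ^ 2) (vertexDot (fun _ : Fin 5 => 1) m) ↔
        m ∈ pathList) := by
  decide +kernel

/-- A height function of the coordinate sum that induces the cone triangulation. -/
def coneHeight (t : ℤ) : ℤ := if t ≤ 1 then 0 else 12 * (100 - t ^ 2)

/-- On the representative with unit vectors `e_1, …, e_k`, `k ≥ 2`, the affine function vanishes at
these and has the value `12 (100 - k ^ 2)` at their sum, so its slope there is this value divided by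
`k - 1`; the factor 12 makes these slopes integral. The remaining slopes are successive differences
of `coneHeight`. -/
theorem cone_height : ∀ L ∈ coneRepresentatives, (∀ m ∈ L, m < 2 ^ 5) ∧
    ∃ a ∈ [(![0, 0, 0, 0, 0], 0), (![225, 225, 225, 225, 225], -225),
      (![336, 336, 336, 336, -108], -336), (![546, 546, 546, -84, -108], -546),
      (![1152, 1152, -60, -84, -108], -1152)], ∀ m < 2 ^ 5,
      vertexDot a.1 m + a.2 ≤ coneHeight (vertexDot (fun _ : Fin 5 => 1) m) ∧
        (vertexDot a.1 m + a.2 = coneHeight (vertexDot (fun _ : Fin 5 => 1) m) ↔ m ∈ L) := by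
  decide +kernel

theorem path_cover {x : EuclideanSpace ℝ (Fin 5)} (hx : x ∈ unitCube 5)
    (h : Antitone (fun i => x i)) : x ∈ convexHull ℝ (vertices 5 pathList) := by
  have h01 := h (show (0 : Fin 5) ≤ 1 by decide)
  have h12 := h (show (1 : Fin 5) ≤ 2 by decide)
  have h23 := h (show (2 : Fin 5) ≤ 3 by decide)
  have h34 := h (show (3 : Fin 5) ≤ 4 by decide)
  have h0 := (hx 0).2
  have h4 := (hx 4).1
  simp only at h01 h12 h23 h34
  refine mem_convexHull_vertices (p := ![0, 1, 3, 7, 15, 31])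
    ![1 - x 0, x 0 - x 1, x 1 - x 2, x 2 - x 3, x 3 - x 4, x 4] ?_ ?_ ?_
  · intro i; fin_cases i <;> simp <;> linarith
  · simp [Fin.sum_univ_six]
  · intro j; fin_cases j <;> simp [Fin.sum_univ_six, Nat.testBit_eq_decide_div_mod_eq]

/-- For the representative with `k` unit vectors, `t` is the total weight of its other vertices, and
`x i - t` are the weights of the units, the last being the smallest. If that one is negative, the
inequality says exactly that the weight of the new vertex is positive when `k` is lowered by one. -/
theorem cone_cover {x : EuclideanSpace ℝ (Fin 5)} (hx : x ∈ unitCube 5)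
    (h : Antitone (fun i => x i)) :
    ∃ L ∈ coneRepresentatives, x ∈ convexHull ℝ (vertices 5 L) := by
  have h01 := h (show (0 : Fin 5) ≤ 1 by decide)
  have h12 := h (show (1 : Fin 5) ≤ 2 by decide)
  have h23 := h (show (2 : Fin 5) ≤ 3 by decide)
  have h34 := h (show (3 : Fin 5) ≤ 4 by decide)
  have h0 := (hx 0).2
  have h4 := (hx 4).1
  simp only at h01 h12 h23 h34
  by_cases c1 : x 0 + x 1 + x 2 + x 3 + x 4 ≤ 1
  · refine ⟨[0, 1, 2, 4, 8, 16], by simp [coneRepresentatives], ?_⟩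
    refine mem_convexHull_vertices (p := ![0, 1, 2, 4, 8, 16])
      ![1 - (x 0 + x 1 + x 2 + x 3 + x 4), x 0, x 1, x 2, x 3, x 4] ?_ ?_ ?_
    · intro i; fin_cases i <;> simp <;> linarith
    · simp [Fin.sum_univ_six]; ring
    · intro j; fin_cases j <;> simp [Fin.sum_univ_six, Nat.testBit_eq_decide_div_mod_eq]
  by_cases c2 : (x 0 + x 1 + x 2 + x 3 + x 4 - 1) / 4 ≤ x 4
  · refine ⟨[31, 1, 2, 4, 8, 16], by simp [coneRepresentatives], ?_⟩
    set t := (x 0 + x 1 + x 2 + x 3 + x 4 - 1) / 4 with ht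
    refine mem_convexHull_vertices (p := ![31, 1, 2, 4, 8, 16])
      ![t, x 0 - t, x 1 - t, x 2 - t, x 3 - t, x 4 - t] ?_ ?_ ?_
    · intro i; fin_cases i <;> simp <;> linarith
    · simp [Fin.sum_univ_six]; linarith
    · intro j; fin_cases j <;> simp [Fin.sum_univ_six, Nat.testBit_eq_decide_div_mod_eq]
  by_cases c3 : (x 0 + x 1 + x 2 + x 3 - 1) / 3 ≤ x 3
  · refine ⟨[31, 15, 1, 2, 4, 8], by simp [coneRepresentatives], ?_⟩
    set t := (x 0 + x 1 + x 2 + x 3 - 1) / 3 with ht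
    refine mem_convexHull_vertices (p := ![31, 15, 1, 2, 4, 8])
      ![x 4, t - x 4, x 0 - t, x 1 - t, x 2 - t, x 3 - t] ?_ ?_ ?_
    · intro i; fin_cases i <;> simp <;> linarith
    · simp [Fin.sum_univ_six]; linarith
    · intro j; fin_cases j <;> simp [Fin.sum_univ_six, Nat.testBit_eq_decide_div_mod_eq]
  by_cases c4 : (x 0 + x 1 + x 2 - 1) / 2 ≤ x 2
  · refine ⟨[31, 15, 7, 1, 2, 4], by simp [coneRepresentatives], ?_⟩
    set t := (x 0 + x 1 + x 2 - 1) / 2 with ht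
    refine mem_convexHull_vertices (p := ![31, 15, 7, 1, 2, 4])
      ![x 4, x 3 - x 4, t - x 3, x 0 - t, x 1 - t, x 2 - t] ?_ ?_ ?_
    · intro i; fin_cases i <;> simp <;> linarith
    · simp [Fin.sum_univ_six]; linarith
    · intro j; fin_cases j <;> simp [Fin.sum_univ_six, Nat.testBit_eq_decide_div_mod_eq]
  · refine ⟨[31, 15, 7, 3, 1, 2], by simp [coneRepresentatives], ?_⟩
    refine mem_convexHull_vertices (p := ![31, 15, 7, 3, 1, 2])
      ![x 4, x 3 - x 4, x 2 - x 3, x 0 + x 1 - 1 - x 2, 1 - x 1, 1 - x 0] ?_ ?_ ?_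
    · intro i; fin_cases i <;> simp <;> linarith
    · simp [Fin.sum_univ_six]
    · intro j; fin_cases j <;> simp [Fin.sum_univ_six, Nat.testBit_eq_decide_div_mod_eq]

theorem isNonobtuseBinaryTriangulation_path :
    IsNonobtuseBinaryTriangulation (permOrbit 5 [pathList]) := by
  refine isNonobtuseBinaryTriangulation_permOrbit (by simpa [pathList] using path_spec)
    (fun t => -t ^ 2) (fun L hL => ?_) fun x hx h => ⟨_, List.mem_singleton_self _, path_cover hx h⟩
  rw [List.mem_singleton.1 hL]
  exact ⟨path_height.1, _, _, path_height.2⟩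

theorem isNonobtuseBinaryTriangulation_cone :
    IsNonobtuseBinaryTriangulation (permOrbit 5 coneRepresentatives) := by
  refine isNonobtuseBinaryTriangulation_permOrbit ?_ coneHeight (fun L hL => ?_)
    fun x hx h => cone_cover hx h
  · simp only [coneRepresentatives, List.forall_mem_cons]
    exact ⟨corner_spec, antipodal_spec, cone4_spec, cone3_spec, cone2_spec, by simp⟩
  · obtain ⟨h1, a, -, h⟩ := cone_height L hL
    exact ⟨h1, _, _, h⟩

/-! ### Identification with the defined triangulations -/

theorem permIsometry_single (σ : Equiv.Perm (Fin n)) (i : Fin n) :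
    permIsometry σ (EuclideanSpace.single i 1) = EuclideanSpace.single (σ i) 1 := by
  ext j
  simp [permIsometry_apply, Equiv.symm_apply_eq]

theorem pathSimplex_eq (σ : Equiv.Perm (Fin 5)) :
    pathSimplex σ = permIsometry σ '' vertices 5 pathList := by
  have h : pathList = List.ofFn fun k : Fin 6 => 2 ^ (k : ℕ) - 1 := by decide +kernel
  rw [h, vertices_ofFn, ← range_comp]
  unfold pathSimplex
  congr 1
  ext k j
  simp only [Function.comp_apply, permIsometry_apply, vertex_apply, Nat.testBit_two_pow_sub_one,
    decide_eq_true_eq, WithLp.ofLp_sum, Finset.sum_apply, PiLp.single_apply]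
  rw [Finset.sum_filter, Finset.sum_eq_single (σ.symm j)]
  · simp
  · intro i _ hi
    have h : j ≠ σ i := fun h => hi (by rw [h, Equiv.symm_apply_apply])
    simp [h]
  · simp

theorem standardTriangulation_eq : standardTriangulation 5 = permOrbit 5 [pathList] := by
  ext S
  simp [standardTriangulation, permOrbit, pathSimplex_eq]

/-- The encoded cube corner at the origin. -/
def cornerList (n : ℕ) : List ℕ := 0 :: (List.finRange n).map fun i => 2 ^ (i : ℕ)

/-- The encoded antipodal of the cube corner. -/
def antipodalList (n : ℕ) : List ℕ := (2 ^ n - 1) :: (List.finRange n).map fun i => 2 ^ (i : ℕ)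

theorem vertex_two_pow (i : Fin n) : vertex n (2 ^ (i : ℕ)) = EuclideanSpace.single i 1 := by
  ext j
  simp [vertex_apply, Nat.testBit_two_pow, Fin.ext_iff, eq_comm]

theorem vertex_two_pow_sub_one (n : ℕ) : vertex n (2 ^ n - 1) = allOnes n := by
  ext j
  simp [vertex_apply, allOnes]

theorem vertices_units (n : ℕ) : vertices n ((List.finRange n).map fun i => 2 ^ (i : ℕ)) =
    range fun i : Fin n => EuclideanSpace.single i (1 : ℝ) := by
  ext x
  simp [vertices, vertex_two_pow]

theorem vertices_cornerList (n : ℕ) : vertices n (cornerList n) = cubeCorner n := by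
  rw [cornerList, vertices_cons, vertices_units, vertex_zero, cubeCorner]

theorem vertices_antipodalList (n : ℕ) : vertices n (antipodalList n) = antipodalSimplex n := by
  rw [antipodalList, vertices_cons, vertices_units, vertex_two_pow_sub_one, antipodalSimplex]

/-- The action of `facetEmbedding` on encoded vertices. -/
def insertBit (j : Fin (n + 1)) (m : ℕ) : ℕ :=
  Nat.ofBits (Fin.insertNth (α := fun _ => Bool) j false fun i : Fin n => m.testBit i)

theorem facetEmbedding_vertex (j : Fin (n + 1)) (m : ℕ) :
    facetEmbedding j (vertex n m) = vertex (n + 1) (insertBit j m) := by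
  ext i
  rw [vertex_apply, insertBit, Nat.testBit_ofBits_lt _ _ i.2, facetEmbedding]
  simp only [Fin.eta]
  refine Fin.succAboveCases j ?_ (fun i => ?_) i
  · simp
  · simp [vertex_apply]

/-- The encoded simplices of the cone triangulation other than the cube corner. -/
def coneLists : ℕ → List (List ℕ)
  | 0 => []
  | 1 => []
  | n + 2 => antipodalList (n + 2) :: (List.finRange (n + 2)).flatMap fun j =>
      (coneLists (n + 1)).map fun R => (2 ^ (n + 2) - 1) :: R.map (insertBit j)

theorem allOnes_notMem_cubeCorner (n : ℕ) : allOnes (n + 2) ∉ cubeCorner (n + 2) := by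
  rintro (h | ⟨i, h⟩)
  · have := congrArg (fun x => x 0) h
    simp [allOnes] at this
  · obtain ⟨j, hj⟩ := exists_ne i
    have := congrArg (fun x => x j) h
    simp [allOnes, hj] at this

theorem vertices_ne_cubeCorner {L : List ℕ} (hL : L ∈ coneLists n) :
    vertices n L ≠ cubeCorner n := by
  match n, hL with
  | n + 2, hL =>
    intro h
    refine allOnes_notMem_cubeCorner n (h ▸ ?_)
    rw [← vertex_two_pow_sub_one]
    refine ⟨_, ?_, rfl⟩
    simp only [coneLists, List.mem_cons, List.mem_flatMap, List.mem_map] at hL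
    rcases hL with rfl | ⟨j, -, R, -, rfl⟩ <;> simp [antipodalList]

/-- No encoded list gives the corner, so the exclusion in the recursive definition drops exactly
that one simplex, and the recursion becomes computable. -/
theorem mem_coneTriangulation : ∀ {n : ℕ} {S : Set (EuclideanSpace ℝ (Fin n))},
    S ∈ coneTriangulation n ↔ S = cubeCorner n ∨ ∃ L ∈ coneLists n, S = vertices n L
  | 0, S => by simp [coneTriangulation, coneLists]
  | 1, S => by simp [coneTriangulation, coneLists]
  | n + 2, S => by
    simp only [coneTriangulation, coneLists, mem_union, mem_insert_iff, mem_singleton_iff,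
      List.mem_cons, List.mem_flatMap, List.mem_map, List.mem_finRange, true_and, or_assoc]
    refine or_congr_right ?_
    have e : ∀ (j : Fin (n + 2)) (L : List ℕ),
        insert (allOnes (n + 2)) (facetEmbedding j '' vertices (n + 1) L) =
          vertices (n + 2) ((2 ^ (n + 2) - 1) :: L.map (insertBit j)) := fun j L => by
      rw [vertices_cons, vertices_map _ _ (facetEmbedding_vertex j), vertex_two_pow_sub_one]
    constructor
    · rintro (rfl | ⟨j, R, hR, hRc, rfl⟩)
      · exact ⟨_, Or.inl rfl, (vertices_antipodalList _).symm⟩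
      · obtain ⟨L, hL, rfl⟩ := (mem_coneTriangulation.1 hR).resolve_left hRc
        exact ⟨_, Or.inr ⟨j, L, hL, rfl⟩, e j L⟩
    · rintro ⟨_, rfl | ⟨j, L, hL, rfl⟩, rfl⟩
      · exact Or.inl (vertices_antipodalList _)
      · exact Or.inr ⟨j, _, mem_coneTriangulation.2 (Or.inr ⟨L, hL, rfl⟩),
          vertices_ne_cubeCorner hL, (e j L).symm⟩

/-- A number that encodes the members of a list. -/
def listCode (L : List ℕ) : ℕ := L.foldr (fun m s => 2 ^ m ||| s) 0

theorem testBit_listCode (L : List ℕ) (m : ℕ) : (listCode L).testBit m = true ↔ m ∈ L := by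
  induction L with
  | nil => simp [listCode]
  | cons a L ih =>
    rw [listCode, List.foldr_cons, Nat.testBit_or, Bool.or_eq_true, Nat.testBit_two_pow]
    rw [listCode] at ih
    simp [ih, eq_comm]

/-- Bit masks ignore order and repetition, so equality of vertex sets reduces to equality of numbers
in the enumerations by `decide`. -/
theorem vertices_eq_of_listCode {L L' : List ℕ} (h : listCode L = listCode L') :
    vertices n L = vertices n L' :=
  vertices_congr fun m => by rw [← testBit_listCode, h, testBit_listCode]

theorem listCode_permute_mem : ∀ σ : Equiv.Perm (Fin 5), ∀ L ∈ coneRepresentatives,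
    listCode (L.map (permuteBits 5 σ)) ∈
      listCode (cornerList 5) :: (coneLists 5).map listCode := by
  decide +kernel

theorem exists_listCode_permute_eq : ∀ c ∈ (coneLists 5).map listCode,
    ∃ σ : Equiv.Perm (Fin 5), ∃ L ∈ coneRepresentatives,
      listCode (L.map (permuteBits 5 σ)) = c := by
  decide +kernel

theorem image_permIsometry_vertices (σ : Equiv.Perm (Fin n)) (L : List ℕ) :
    permIsometry σ '' vertices n L = vertices n (L.map (permuteBits n σ.symm)) :=
  (vertices_map _ _ (permIsometry_vertex σ) L).symm

theorem cornerList_mem_coneRepresentatives : cornerList 5 ∈ coneRepresentatives := by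
  decide +kernel

theorem image_permIsometry_cubeCorner (σ : Equiv.Perm (Fin n)) :
    permIsometry σ '' cubeCorner n = cubeCorner n := by
  have h0 : permIsometry σ 0 = 0 := by ext i; simp [permIsometry_apply]
  rw [cubeCorner, image_insert_eq, h0, ← range_comp]
  congr 1
  have : (permIsometry σ ∘ fun i : Fin n => EuclideanSpace.single i (1 : ℝ)) =
      (fun i : Fin n => EuclideanSpace.single i (1 : ℝ)) ∘ σ := by
    ext i : 1
    exact permIsometry_single σ i
  rw [this, σ.surjective.range_comp]

theorem coneTriangulation_eq : coneTriangulation 5 = permOrbit 5 coneRepresentatives := by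
  ext S
  rw [mem_coneTriangulation]
  constructor
  · rintro (rfl | ⟨L, hL, rfl⟩)
    · refine ⟨Equiv.refl _, _, cornerList_mem_coneRepresentatives, ?_⟩
      rw [vertices_cornerList, image_permIsometry_cubeCorner]
    · obtain ⟨σ, L', hL', h⟩ := exists_listCode_permute_eq _ (List.mem_map_of_mem hL)
      exact ⟨σ.symm, L', hL', by
        rw [image_permIsometry_vertices]; exact vertices_eq_of_listCode h⟩
  · rintro ⟨σ, L, hL, rfl⟩
    rw [image_permIsometry_vertices]
    rcases List.mem_cons.1 (listCode_permute_mem σ.symm L hL) with h | h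
    · left
      rw [vertices_eq_of_listCode h, vertices_cornerList]
    · obtain ⟨L', hL', h'⟩ := List.mem_map.1 h
      exact Or.inr ⟨L', hL', vertices_eq_of_listCode h'.symm⟩

/-! ### Propagation from simplex to simplex -/

/-- One crossing of the facet `F`. With `qs = []` the hypothesis on neighbours is void, which is how
impossible simplices are excluded. -/
theorem forces_of_certificate {L : List ℕ} (p : ℕ) (F qs : List ℕ) (ν : Fin 5 → ℤ) (c : ℤ)
    (certs : List ((Fin 5 → ℤ) × ℤ)) (hL : listCode L = listCode (p :: F))
    (h : IsNeighborCertificate p F qs ν c certs) (hq : ∀ q ∈ qs, Forces 5 (q :: F)) :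
    Forces 5 L := by
  intro T hT hS
  rw [vertices_eq_of_listCode hL] at hS
  obtain ⟨q, hqs, h'⟩ := h.exists_neighbor (by norm_num) hT hS
  exact hq q hqs T hT h'

theorem mem_of_certificate {T : Set (Set (EuclideanSpace ℝ (Fin 5)))}
    (hT : IsNonobtuseBinaryTriangulation T) {L L' : List ℕ} (hS : vertices 5 L ∈ T) (p : ℕ)
    (F : List ℕ) (q : ℕ) (ν : Fin 5 → ℤ) (c : ℤ) (certs : List ((Fin 5 → ℤ) × ℤ))
    (hL : listCode L = listCode (p :: F)) (h : IsNeighborCertificate p F [q] ν c certs)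
    (hL' : listCode L' = listCode (q :: F)) : vertices 5 L' ∈ T := by
  rw [vertices_eq_of_listCode hL] at hS
  obtain ⟨q', hq', h'⟩ := h.exists_neighbor (by norm_num) hT hS
  rwa [vertices_eq_of_listCode hL', ← List.mem_singleton.1 hq']

/-- Exchanging two consecutive steps of a path changes just one intermediate vertex, and the
certificates leave that exchange as the only neighbour. -/
theorem path_swap_mem {T : Set (Set (EuclideanSpace ℝ (Fin 5)))}
    (hT : IsNonobtuseBinaryTriangulation T) (h : vertices 5 pathList ∈ T) (i : Fin 4) :
    permIsometry (Equiv.swap i.castSucc i.succ) '' vertices 5 pathList ∈ T := by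
  rw [image_permIsometry_vertices]
  fin_cases i
  · exact mem_of_certificate hT h 1 [0, 3, 7, 15, 31] 2 ![-1, 1, 0, 0, 0] 0
      [(![0, 1, 0, 0, -1], 0), (![0, 1, 0, -1, 0], 0), (![0, 1, -1, 0, 0], 0)]
      (by decide +kernel) (by decide +kernel) (by decide +kernel)
  · exact mem_of_certificate hT h 3 [0, 1, 7, 15, 31] 5 ![0, -1, 1, 0, 0] 0
      [(![0, 0, 1, 0, -1], 0), (![0, 0, 1, -1, 0], 0), (![1, -1, 0, 0, 0], 0)]
      (by decide +kernel) (by decide +kernel) (by decide +kernel)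
  · exact mem_of_certificate hT h 7 [0, 1, 3, 15, 31] 11 ![0, 0, -1, 1, 0] 0
      [(![0, 0, 0, 1, -1], 0), (![0, 1, -1, 0, 0], 0), (![1, 0, -1, 0, 0], 0)]
      (by decide +kernel) (by decide +kernel) (by decide +kernel)
  · exact mem_of_certificate hT h 15 [0, 1, 3, 7, 31] 23 ![0, 0, 0, -1, 1] 0
      [(![0, 0, 1, -1, 0], 0), (![1, 1, -1, -1, 0], 0)]
      (by decide +kernel) (by decide +kernel) (by decide +kernel)

/-- A chain of crossings, replacing 0 by 31, 16 by 15, 8 by 7 and 4 by 3. -/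
theorem coneRepresentatives_mem {T : Set (Set (EuclideanSpace ℝ (Fin 5)))}
    (hT : IsNonobtuseBinaryTriangulation T) (h : vertices 5 (cornerList 5) ∈ T) :
    ∀ L ∈ coneRepresentatives, vertices 5 L ∈ T := by
  have h0 : vertices 5 [0, 1, 2, 4, 8, 16] ∈ T := h
  have h1 : vertices 5 [31, 1, 2, 4, 8, 16] ∈ T :=
     mem_of_certificate hT h0 0 [1, 2, 4, 8, 16] 31 ![1, 1, 1, 1, 1] 1
      [(![0, 0, 0, 0, 1], 0), (![0, 0, 0, 1, 0], 0), (![0, 0, 1, 0, 0], 0),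
        (![2, 2, -1, -1, -1], -1)]
      (by decide +kernel) (by decide +kernel) (by decide +kernel)
  have h2 : vertices 5 [31, 15, 1, 2, 4, 8] ∈ T :=
     mem_of_certificate hT h1 16 [31, 1, 2, 4, 8] 15 ![1, 1, 1, 1, -3] 1
      [(![0, 0, 0, 1, 0], 0), (![0, 0, 1, 0, 0], 0), (![1, 1, -1, -1, -1], -1)]
      (by decide +kernel) (by decide +kernel) (by decide +kernel)
  have h3 : vertices 5 [31, 15, 7, 1, 2, 4] ∈ T :=
     mem_of_certificate hT h2 8 [31, 15, 1, 2, 4] 7 ![1, 1, 1, -2, 0] 1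
      [(![0, 0, 1, 0, -1], 0), (![0, 1, 0, 0, 0], 0), (![1, 0, 0, 0, 0], 0)]
      (by decide +kernel) (by decide +kernel) (by decide +kernel)
  have h4 : vertices 5 [31, 15, 7, 3, 1, 2] ∈ T :=
     mem_of_certificate hT h3 4 [31, 15, 7, 1, 2] 3 ![1, 1, -1, 0, 0] 1
      [(![1, 1, 1, -1, -1], 1)]
      (by decide +kernel) (by decide +kernel) (by decide +kernel)
  simp only [coneRepresentatives, List.forall_mem_cons]
  exact ⟨h0, h1, h2, h3, h4, by simp⟩

theorem image_permIsometry_mul (σ τ : Equiv.Perm (Fin n)) (S : Set (EuclideanSpace ℝ (Fin n))) :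
    permIsometry (σ * τ) '' S = permIsometry σ '' (permIsometry τ '' S) := by
  rw [← image_comp]
  congr 1

/-- Adjacent transpositions generate the symmetric group. Each step on the right is applied to the
triangulation pulled back by `σ`. -/
theorem permOrbit_path_subset {T : Set (Set (EuclideanSpace ℝ (Fin 5)))}
    (hT : IsNonobtuseBinaryTriangulation T) (h : vertices 5 pathList ∈ T) :
    permOrbit 5 [pathList] ⊆ T := by
  rintro _ ⟨σ, L, hL, rfl⟩
  rw [List.mem_singleton.1 hL]
  have hσ : σ ∈ Submonoid.closure
      (range fun i : Fin 4 => Equiv.swap i.castSucc i.succ) := by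
    rw [Equiv.Perm.mclosure_swap_castSucc_succ]
    trivial
  induction hσ using Submonoid.closure_induction_right with
  | one =>
    have : permIsometry (1 : Equiv.Perm (Fin 5)) '' vertices 5 pathList = vertices 5 pathList := by
      have e : ⇑(permIsometry (1 : Equiv.Perm (Fin 5))) = id := by
        ext x i
        rfl
      rw [e, image_id]
    rwa [this]
  | mul_right σ _ τ hτ ih =>
    obtain ⟨i, rfl⟩ := hτ
    rw [image_permIsometry_mul, ← mem_mapSimplices_symm]
    exact path_swap_mem (hT.mapSimplices (isCubeSymmetry_permIsometry σ).symm)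
      (mem_mapSimplices_symm.2 ih) i

/-- The corner is fixed by coordinate permutations, so the chain of crossings can be run in every
pulled-back triangulation. -/
theorem permOrbit_cone_subset {T : Set (Set (EuclideanSpace ℝ (Fin 5)))}
    (hT : IsNonobtuseBinaryTriangulation T) (h : vertices 5 (cornerList 5) ∈ T) :
    permOrbit 5 coneRepresentatives ⊆ T := by
  rintro _ ⟨σ, L, hL, rfl⟩
  rw [← mem_mapSimplices_symm]
  refine coneRepresentatives_mem (hT.mapSimplices (isCubeSymmetry_permIsometry σ).symm) ?_ L hL
  rw [mem_mapSimplices_symm, vertices_cornerList, image_permIsometry_cubeCorner,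
    ← vertices_cornerList]
  exact h

theorem isCubeSymmetry_refl : IsCubeSymmetry (AffineIsometryEquiv.refl ℝ
    (EuclideanSpace ℝ (Fin n))) := by
  simp [IsCubeSymmetry]

theorem mapSimplices_refl (T : Set (Set (EuclideanSpace ℝ (Fin n)))) :
    mapSimplices (AffineIsometryEquiv.refl ℝ (EuclideanSpace ℝ (Fin n))) T = T := by
  simp [mapSimplices]

theorem forces_path : Forces 5 pathList := by
  intro T hT h
  refine ⟨_, isCubeSymmetry_refl, Or.inl ?_⟩
  rw [mapSimplices_refl, standardTriangulation_eq]
  exact hT.1.eq_of_subset isNonobtuseBinaryTriangulation_path.1 (permOrbit_path_subset hT h)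

theorem forces_corner : Forces 5 (cornerList 5) := by
  intro T hT h
  refine ⟨_, isCubeSymmetry_refl, Or.inr ?_⟩
  rw [mapSimplices_refl, coneTriangulation_eq]
  exact hT.1.eq_of_subset isNonobtuseBinaryTriangulation_cone.1 (permOrbit_cone_subset hT h)

/-- The chain from the corner is run backwards, ending with 31 replaced by 0. -/
theorem forces_cone2 : Forces 5 [31, 15, 7, 3, 1, 2] := by
  refine forces_of_certificate 3 [31, 15, 7, 1, 2] [4] ![-1, -1, 1, 0, 0] (-1)
      [(![0, 0, 1, 0, -1], 0), (![0, 0, 1, -1, 0], 0), (![0, -1, 0, 0, 0], -1),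
        (![-1, 0, 0, 0, 0], -1)]
      (by decide +kernel) (by decide +kernel) ?_
  rw [List.forall_mem_singleton]
  refine forces_of_certificate 7 [4, 31, 15, 1, 2] [8] ![-1, -1, -1, 2, 0] (-1)
      [(![0, 0, 0, 1, -1], 0), (![0, 0, -1, 0, 0], -1), (![-1, -1, 1, 0, 0], -1)]
      (by decide +kernel) (by decide +kernel) ?_
  rw [List.forall_mem_singleton]
  refine forces_of_certificate 15 [8, 4, 31, 1, 2] [16] ![-1, -1, -1, -1, 3] (-1)
      [(![0, 0, 0, -1, 0], -1), (![-1, -1, -1, 2, 0], -1), (![0, 0, 0, 0, 1], 0)]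
      (by decide +kernel) (by decide +kernel) ?_
  rw [List.forall_mem_singleton]
  refine forces_of_certificate 31 [16, 8, 4, 1, 2] [0] ![-1, -1, -1, -1, -1] (-1)
      []
      (by decide +kernel) (by decide +kernel) ?_
  rw [List.forall_mem_singleton]
  exact forces_corner.congr (by simp [cornerList, List.finRange_succ]; omega)

/-- Each crossing has a single candidate until a facet admits none, so no nonobtuse triangulation
contains this simplex. The next two trees are excluded in the same way. -/
theorem forces_spider122 : Forces 5 [0, 1, 2, 4, 9, 18] := by
  refine forces_of_certificate 0 [1, 2, 4, 9, 18] [7] ![1, 1, 1, 0, 0] 1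
      [(![0, 1, 0, 0, -1], 0), (![1, 0, 0, -1, 0], 0), (![0, 0, 1, 0, 0], 0)]
      (by decide +kernel) (by decide +kernel) ?_
  rw [List.forall_mem_singleton]
  refine forces_of_certificate 1 [7, 2, 4, 9, 18] [14] ![-1, 1, 1, 2, 0] 1
      [(![0, 1, 0, 0, -1], 0), (![-1, -1, 1, 0, 0], -1), (![0, 0, 0, 1, 0], 0)]
      (by decide +kernel) (by decide +kernel) ?_
  rw [List.forall_mem_singleton]
  refine forces_of_certificate 2 [14, 7, 4, 9, 18] [29] ![1, -1, 2, 1, 3] 2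
      [(![0, 0, 0, 1, 0], 0), (![0, -1, 1, -1, 0], -1), (![1, 1, 0, -1, 1], 0)]
      (by decide +kernel) (by decide +kernel) ?_
  rw [List.forall_mem_singleton]
  refine forces_of_certificate 4 [29, 14, 7, 9, 18] [] ![2, 3, -1, 2, 1] 4
      [(![1, 1, 1, -1, -1], 0), (![0, 0, 0, 0, 1], 0), (![0, 0, -1, 1, -1], -1)]
      (by decide +kernel) (by decide +kernel) ?_
  simp

theorem forces_spider1112 : Forces 5 [0, 1, 2, 4, 8, 17] := by
  refine forces_of_certificate 0 [1, 2, 4, 8, 17] [15] ![1, 1, 1, 1, 0] 1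
      [(![1, 0, 0, 0, -1], 0), (![0, 0, 0, 1, 0], 0), (![0, 0, 1, 0, 0], 0), (![0, 1, 0, 0, 0], 0)]
      (by decide +kernel) (by decide +kernel) ?_
  rw [List.forall_mem_singleton]
  refine forces_of_certificate 1 [15, 2, 4, 8, 17] [30] ![-2, 1, 1, 1, 3] 1
      [(![0, 0, 0, 1, 0], 0), (![-1, 0, 1, -1, 0], -1), (![0, 1, -1, -1, 1], -1)]
      (by decide +kernel) (by decide +kernel) ?_
  rw [List.forall_mem_singleton]
  refine forces_of_certificate 2 [30, 15, 4, 8, 17] [] ![1, -3, 2, 2, 1] 2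
      [(![-1, -1, 1, -1, -1], -2), (![0, 0, 0, 0, 1], 0), (![1, 0, 0, 1, -1], 0)]
      (by decide +kernel) (by decide +kernel) ?_
  simp

theorem forces_doubleStar : Forces 5 [0, 1, 2, 4, 9, 17] := by
  refine forces_of_certificate 0 [1, 2, 4, 9, 17] [7] ![1, 1, 1, 0, 0] 1
      [(![1, 0, 0, -1, -1], 0), (![0, 0, 1, 0, 0], 0), (![0, 1, 0, 0, 0], 0)]
      (by decide +kernel) (by decide +kernel) ?_
  rw [List.forall_mem_singleton]
  refine forces_of_certificate 1 [7, 2, 4, 9, 17] [30] ![-1, 1, 1, 2, 2] 1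
      [(![0, 0, 1, 0, 0], 0), (![-1, 1, -1, 0, 0], -1), (![1, -1, -1, 1, 1], -1)]
      (by decide +kernel) (by decide +kernel) ?_
  rw [List.forall_mem_singleton]
  refine forces_of_certificate 2 [30, 7, 4, 9, 17] [] ![2, -2, 3, 1, 1] 3
      [(![1, 1, 1, -1, -1], 0), (![0, 0, 0, 0, 1], 0), (![0, -1, 0, 1, -1], -1)]
      (by decide +kernel) (by decide +kernel) ?_
  simp
-- Enumeration of the trees and conclusion
/-- The encoded vertex sets of the simplices that are built up from the origin by successively
adding, in each of the first `k` coordinate directions, the translate of a previous vertex. -/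
def trees : ℕ → List (List ℕ)
  | 0 => [[0]]
  | k + 1 => (trees k).flatMap fun L => L.map fun a => (a ^^^ 2 ^ k) :: L

theorem exists_mem_trees {p : Fin n → EuclideanSpace ℝ (Fin n)}
    (hp : ∀ j, p j ∈ cubeVertices n)
    (h : ∀ j, p j - EuclideanSpace.single j 1 ∈ insert 0 (p '' {i | i < j})) {k : ℕ} (hk : k ≤ n) :
    ∃ L ∈ trees k, vertices n L = insert 0 (p '' {i | (i : ℕ) < k}) := by
  induction k with
  | zero =>
    refine ⟨[0], List.mem_singleton_self _, ?_⟩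
    simp [vertices, vertex_zero, eq_comm]
  | succ k ih =>
    obtain ⟨L, hL, hLv⟩ := ih (by omega)
    set K : Fin n := ⟨k, hk⟩ with hK
    have hpK : p K - EuclideanSpace.single K 1 ∈ vertices n L := hLv ▸ h K
    obtain ⟨a, ha, hap⟩ := hpK
    -- Adding `e_K` must stay in the cube, so bit `k` of `a` is clear and the exclusive or acts as
    -- this addition.
    have hak : a.testBit k = false := by
      by_contra hc
      rw [Bool.not_eq_false] at hc
      have := congrArg (fun x => x K) hap
      simp only [vertex_apply, hK, hc, if_true, PiLp.sub_apply, PiLp.single_apply] at this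
      rcases hp K K with h | h <;> rw [hK] at h <;> rw [h] at this <;> norm_num at this
    have hv : vertex n (a ^^^ 2 ^ k) = p K := by
      rw [← sub_add_cancel (p K) (EuclideanSpace.single K 1), ← hap]
      ext i
      by_cases hi : i = K
      · rw [hi]
        simp [vertex_apply, hK, hak, Nat.testBit_xor]
      · have hi' : k ≠ (i : ℕ) := fun h => hi (Fin.ext h.symm)
        simp [vertex_apply, hi, Nat.testBit_xor, hi']
    refine ⟨(a ^^^ 2 ^ k) :: L, List.mem_flatMap.2 ⟨L, hL, List.mem_map_of_mem ha⟩, ?_⟩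
    rw [vertices_cons, hv, hLv, insert_comm, ← image_insert_eq]
    congr 2
    ext i
    simp only [mem_insert_iff, mem_ofPred_eq, hK, Fin.ext_iff]
    omega

/-- Representatives of the trees up to symmetry. -/
def treeRepresentatives : List (List ℕ) :=
  [pathList, cornerList 5, [28, 12, 4, 0, 2, 1], [0, 1, 2, 4, 9, 18], [0, 1, 2, 4, 8, 17],
    [0, 1, 2, 4, 9, 17]]

theorem forces_treeRepresentatives : ∀ R ∈ treeRepresentatives, Forces 5 R := by
  simp only [treeRepresentatives, List.forall_mem_cons]
  -- Reflecting in the first two coordinates turns the spider with legs 1, 1, 3 into a cone simplex.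
  exact ⟨forces_path, forces_corner, Forces.of_xor 3 forces_cone2, forces_spider122,
    forces_spider1112, forces_doubleStar, by simp⟩

/-- Permutations of the coordinates that suffice to bring all trees into normal form. -/
def treePermutations : List (List (Fin 5)) :=
  [[0, 1, 2, 3, 4], [1, 2, 0, 3, 4], [1, 0, 2, 3, 4], [0, 1, 4, 2, 3], [0, 1, 3, 4, 2],
   [1, 0, 4, 2, 3], [1, 0, 3, 4, 2], [2, 1, 0, 3, 4], [1, 2, 3, 0, 4], [2, 0, 3, 1, 4],
   [1, 2, 0, 4, 3], [2, 3, 1, 0, 4], [3, 2, 1, 0, 4], [2, 3, 1, 4, 0], [0, 3, 1, 2, 4],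
   [0, 4, 1, 2, 3], [0, 3, 1, 4, 2], [0, 2, 3, 1, 4], [0, 3, 2, 1, 4], [0, 2, 3, 4, 1],
   [2, 0, 1, 3, 4], [3, 0, 1, 2, 4], [4, 0, 1, 2, 3], [3, 0, 1, 4, 2], [3, 0, 2, 1, 4],
   [2, 0, 3, 4, 1], [3, 2, 0, 4, 1], [2, 3, 4, 0, 1], [3, 2, 4, 0, 1], [3, 4, 2, 0, 1],
   [4, 3, 2, 0, 1]]

/-- The mask 31 has all five low bits set: every value occurs, so each list is a permutation. -/
theorem listCode_treePermutations : ∀ l ∈ treePermutations,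
    listCode ((List.finRange 5).map fun i : Fin 5 => ((l.getD i 0 : Fin 5) : ℕ)) = 31 := by
  decide +kernel

theorem injective_of_mem_treePermutations {l : List (Fin 5)} (hl : l ∈ treePermutations) :
    Function.Injective fun i : Fin 5 => l.getD i 0 := by
  refine Finite.injective_iff_surjective.2 fun j => ?_
  have h : (j : ℕ) ∈ (List.finRange 5).map fun i : Fin 5 => ((l.getD i 0 : Fin 5) : ℕ) := by
    rw [← testBit_listCode, listCode_treePermutations l hl]
    revert j
    decide
  obtain ⟨i, -, hi⟩ := List.mem_map.1 h
  exact ⟨i, Fin.ext hi⟩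

/-- Translates of trees to the origin, up to translations of the trees. -/
def treeTranslates : List (List ℕ) :=
  treeRepresentatives.flatMap fun R => treePermutations.map fun l => R.map (permuteBits 5 fun i => l.getD i 0)

/-- Each direction labels exactly one edge of a tree, so moving a suitable vertex to the origin and
relabelling directions leaves only the isomorphism type. -/
theorem exists_translate : ∀ L ∈ trees 5, ∃ a ∈ L,
    listCode (L.map (· ^^^ a)) ∈ treeTranslates.map listCode := by
  decide +kernel

theorem IsNonobtuseBinaryTriangulation.isStandardOrCone {T : Set (Set (EuclideanSpace ℝ (Fin 5)))}
    (hT : IsNonobtuseBinaryTriangulation T) : IsStandardOrCone T := by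
  obtain ⟨p, hpT, hp⟩ := hT.exists_tree (by norm_num)
  obtain ⟨L, hL, hLv⟩ := exists_mem_trees (fun j => (hT.1.isBinarySimplex _ hpT).subset_cubeVertices
    (mem_insert_of_mem _ (mem_range_self j))) hp le_rfl
  have e : {i : Fin 5 | (i : ℕ) < 5} = univ := by ext i; simp
  rw [e, image_univ] at hLv
  obtain ⟨a, -, ha⟩ := exists_translate L hL
  obtain ⟨_, hL', hc⟩ := List.mem_map.1 ha
  obtain ⟨R, hR, hRf⟩ := List.mem_flatMap.1 hL'
  obtain ⟨l, hl, rfl⟩ := List.mem_map.1 hRf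
  have hF : Forces 5 L := .of_xor a (((forces_treeRepresentatives R hR).permuteBits
    (injective_of_mem_treePermutations hl)).congr fun m => by
      rw [← testBit_listCode, hc, testBit_listCode])
  exact hF T hT (hLv ▸ hpT)

end CubeTriangulation

end

theorem mainTheorem6 (T : Set (Set (EuclideanSpace ℝ (Fin 5)))) :
    CubeTriangulation.IsNonobtuseBinaryTriangulation T ↔
      ∃ g : EuclideanSpace ℝ (Fin 5) ≃ᵃⁱ[ℝ] EuclideanSpace ℝ (Fin 5),
        CubeTriangulation.IsCubeSymmetry g ∧
          (T = CubeTriangulation.mapSimplices g (CubeTriangulation.standardTriangulation 5) ∨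
            T = CubeTriangulation.mapSimplices g (CubeTriangulation.coneTriangulation 5)) := by
  refine ⟨fun hT => hT.isStandardOrCone, ?_⟩
  rintro ⟨g, hg, rfl | rfl⟩
  · rw [CubeTriangulation.standardTriangulation_eq]
    exact CubeTriangulation.isNonobtuseBinaryTriangulation_path.mapSimplices hg
  · rw [CubeTriangulation.coneTriangulation_eq]
    exact CubeTriangulation.isNonobtuseBinaryTriangulation_cone.mapSimplices hg
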